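/- Let $M>0$ and let $g_{ab}$ be the Schwarzschild exterior metric $ds^2=\frac{\Delta}{r^2}dt^2-\frac{r^2}{\Delta}dr^2-r^2(d\theta^2+\sin^2\theta\,d\phi^2)$, $\Delta=r(r-2M)$, $r>2M$, with covariant derivative $\nabla_a$. Use the Carter null frame $l^a=\frac{1}{\sqrt2 r}\big(\frac{r^2}{\sqrt\Delta}\partial_t+\sqrt\Delta\,\partial_r\big)$, $n^a=\frac{1}{\sqrt2 r}\big(\frac{r^2}{\sqrt\Delta}\partial_t-\sqrt\Delta\,\partial_r\big)$, $m^a=\frac{1}{\sqrt2 r}\big(\partial_\theta+\frac{i}{\sin\theta}\partial_\phi\big)$, with spin coefficients $\rho=-\rho'=-\frac{\sqrt\Delta}{\sqrt2 r^2}$, $\beta=\beta'=\frac{\cot\theta}{2\sqrt2 r}$, $\epsilon=-\epsilon'=\frac{M}{2\sqrt{2\Delta}\,r}$ and $\Psi_2=-M/r^3$. On a scalar $\xi$ of GHP weight $(p,q)$ put $\text{þ}\xi=(l^a\nabla_a-p\epsilon-q\bar\epsilon)\xi$, $\eth\xi=(m^a\nabla_a-p\beta+q\bar\beta')\xi$,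 $\text{þ}'\xi=(n^a\nabla_a+p\epsilon'+q\bar\epsilon')\xi$, $\eth'\xi=(\bar m^a\nabla_a+p\beta'-q\bar\beta)\xi$; these have weights $(p+1,q+1)$, $(p+1,q-1)$, $(p-1,q-1)$, $(p-1,q+1)$. A Hertz potential is a scalar $\psi$ of GHP weight $(-4,0)$, smooth on the exterior (that is, the tensor $\psi\,m^am^b$ is smooth on the whole exterior, including the axis $\theta=0,\pi$), with $\mathcal O^\dagger[\psi]=\big[(\text{þ}'-\bar\rho')(\text{þ}+3\rho)-\eth'\eth-3\Psi_2\big]\psi=0$. It generates the complex metric perturbation $\gamma=\mathcal S^\dagger[\psi]$, $$\gamma_{ab}=-l_al_b\,U+l_{(a}m_{b)}V-m_am_b\,W,\quad U=\eth^2\psi,\quad V=[\text{þ}\eth+\eth(\text{þ}+3\rho)]\psi,\quad W=(\text{þ}-\rho)(\text{þ}+3\rho)\psi .$$ For complex perturbations let $w^a(\gamma,\gamma')=P^{abcdef}(\gamma'_{bc}\nabla_d\gamma_{ef}-\gamma_{bc}\nabla_d\gamma'_{ef})$ with $P^{abcdef}=g^{ae}g^{fb}g^{cd}-\frac12g^{ad}g^{be}g^{fc}-\frac12g^{ab}g^{cd}g^{ef}-\frac12g^{bc}g^{ae}g^{fd}+\frac12g^{bc}g^{ad}g^{ef}$,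 and let $\Omega(\gamma,\gamma')=\int_\Sigma u_aw^a(\gamma,\gamma')$, where $\Sigma$ is a surface $t=\tau$ with unit normal $u^a$ and its induced volume element. For a real perturbation $\gamma$ let $\mathscr E(\gamma)=\Omega(\gamma,\mathcal L_{\partial_t}\gamma)$. Let $\mathcal T[\gamma]$ be the perturbation of the Weyl scalar $\Psi_0=-C_{abcd}l^am^bl^cm^d$ due to $\gamma$. Then for every $\tau\in\mathbb R$: 1. if $\psi,\psi'$ are Hertz potentials, $\gamma=\mathcal S^\dagger[\psi]$ and $\gamma'=\mathcal S^\dagger[\psi']$, then the integral $\Omega(\gamma,\gamma')$ converges absolutely and $\Omega(\gamma,\gamma')=0$; 2. if $\psi$ is a Hertz potential and $\gamma=\mathcal S^\dagger[\psi]$, then the integral for $\mathscr E(\operatorname{Re}\gamma)$ converges absolutely if and only if the one for $\mathscr E(\operatorname{Im}\gamma)$ does, and then $\mathscr E(\operatorname{Re}\gamma)=\mathscr E(\operatorname{Im}\gamma)$; 3. if $\psi$ is a Hertz potential and $\gamma=\mathcal S^\dagger[\psi]$, then $\mathcal T[\gamma]=0$. -/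

import Mathlib

open scoped ContDiff

noncomputable section

namespace Schwarzschild

/-! ## The exterior in Schwarzschild coordinates `x = (t, r, θ, φ)` -/

/-- A coordinate tuple `(t, r, θ, φ)`. -/
abbrev Point := Fin 4 → ℝ

/-- A (complex) tensor field with two lower indices, by its coordinate components. -/
abbrev Tensor2 := Point → Fin 4 → Fin 4 → ℂ

/-- The exterior of the black hole of mass `M`, without the axis `θ = 0, π`. The angle `φ` runs
through `ℝ`; see `IsHertzPotential` for periodicity and for regularity at the axis. -/
def exterior (M : ℝ) : Set Point := {x | 2 * M < x 1 ∧ 0 < x 2 ∧ x 2 < Real.pi}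

/-- `Δ = r (r - 2 M)`. -/
def Delta (M : ℝ) (x : Point) : ℝ := x 1 * (x 1 - 2 * M)

/-- The Schwarzschild metric `g_{ab}`, signature `(+,-,-,-)`. -/
def metric (M : ℝ) (x : Point) : Matrix (Fin 4) (Fin 4) ℝ :=
  Matrix.diagonal ![Delta M x / x 1 ^ 2, -(x 1 ^ 2 / Delta M x), -(x 1 ^ 2),
    -(x 1 ^ 2 * Real.sin (x 2) ^ 2)]

/-- The inverse metric `g^{ab}`. -/
def metricInv (M : ℝ) (x : Point) : Matrix (Fin 4) (Fin 4) ℝ := (metric M x)⁻¹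

/-- The coordinate derivative `∂_a f`. -/
def pd {E : Type*} [NormedAddCommGroup E] [NormedSpace ℝ E] (a : Fin 4) (f : Point → E)
    (x : Point) : E :=
  fderiv ℝ f x (Pi.single a 1)

/-- The Christoffel symbol `Γ^a_{bc}` of the Schwarzschild metric. -/
def christoffel (M : ℝ) (a b c : Fin 4) (x : Point) : ℝ :=
  (1 / 2) * ∑ d, metricInv M x a d *
    (pd b (fun y => metric M y d c) x + pd c (fun y => metric M y b d) x
      - pd d (fun y => metric M y b c) x)

/-- The covariant derivative `∇_d γ_{ef}`. -/
def cov2 (M : ℝ) (γ : Tensor2) (x : Point) (d e f : Fin 4) : ℂ :=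
  pd d (fun y => γ y e f) x - ∑ k, (christoffel M k d e x : ℂ) * γ x k f
    - ∑ k, (christoffel M k d f x : ℂ) * γ x e k

/-- The covariant derivative `∇_a S_{dbc}` of a tensor with three lower indices. -/
def cov3 (M : ℝ) (S : Point → Fin 4 → Fin 4 → Fin 4 → ℂ) (x : Point) (a d b c : Fin 4) : ℂ :=
  pd a (fun y => S y d b c) x - ∑ k, (christoffel M k a d x : ℂ) * S x k b c
    - ∑ k, (christoffel M k a b x : ℂ) * S x d k c
    - ∑ k, (christoffel M k a c x : ℂ) * S x d b k

/-! ## The Carter frame and the GHP operators -/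

/-- `l^a` of the Carter frame. -/
def lVec (M : ℝ) (x : Point) : Fin 4 → ℂ := fun a =>
  ((1 / (√2 * x 1) * (![x 1 ^ 2 / √(Delta M x), √(Delta M x), 0, 0] : Fin 4 → ℝ) a : ℝ) : ℂ)

/-- `n^a` of the Carter frame. -/
def nVec (M : ℝ) (x : Point) : Fin 4 → ℂ := fun a =>
  ((1 / (√2 * x 1) * (![x 1 ^ 2 / √(Delta M x), -√(Delta M x), 0, 0] : Fin 4 → ℝ) a : ℝ) : ℂ)

/-- `m^a` of the Carter frame. -/
def mVec (x : Point) : Fin 4 → ℂ := fun a =>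
  ((1 / (√2 * x 1) : ℝ) : ℂ) *
    (![0, 0, 1, Complex.I / ((Real.sin (x 2) : ℝ) : ℂ)] : Fin 4 → ℂ) a

/-- The complex conjugate of `m^a`. -/
def mbarVec (x : Point) : Fin 4 → ℂ := fun a => starRingEnd ℂ (mVec x a)

/-- Lowering an index: `v_a = g_{ab} v^b`. -/
def lower (M : ℝ) (x : Point) (v : Fin 4 → ℂ) (a : Fin 4) : ℂ :=
  ∑ b, (metric M x a b : ℂ) * v b

/-- The derivative `v^a ∂_a ξ` of a scalar. -/
def along (v : Point → Fin 4 → ℂ) (ξ : Point → ℂ) (x : Point) : ℂ :=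
  ∑ a, v x a * pd a ξ x

/-- The spin coefficient `ρ` in the Carter frame. -/
def rho (M : ℝ) (x : Point) : ℂ := ((-(√(Delta M x) / (√2 * x 1 ^ 2)) : ℝ) : ℂ)

/-- The spin coefficient `ρ'`. -/
def rho' (M : ℝ) (x : Point) : ℂ := -rho M x

/-- The spin coefficient `β`. -/
def beta (x : Point) : ℂ := ((Real.cot (x 2) / (2 * √2 * x 1) : ℝ) : ℂ)

/-- The spin coefficient `β'`. -/
def beta' (x : Point) : ℂ := beta x

/-- The spin coefficient `ε`. -/
def eps (M : ℝ) (x : Point) : ℂ := ((M / (2 * √(2 * Delta M x) * x 1) : ℝ) : ℂ)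

/-- The spin coefficient `ε'`. -/
def eps' (M : ℝ) (x : Point) : ℂ := -eps M x

/-- The background Weyl scalar `Ψ₂`. -/
def Psi2 (M : ℝ) (x : Point) : ℂ := ((-(M / x 1 ^ 3) : ℝ) : ℂ)

/-- The GHP operator `þ` on scalars of weight `(p, q)`; the result has weight `(p+1, q+1)`. -/
def thorn (M : ℝ) (p q : ℤ) (ξ : Point → ℂ) (x : Point) : ℂ :=
  along (lVec M) ξ x - p * eps M x * ξ x - q * starRingEnd ℂ (eps M x) * ξ x

/-- The GHP operator `ð` on scalars of weight `(p, q)`; the result has weight `(p+1, q-1)`. -/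
def eth (p q : ℤ) (ξ : Point → ℂ) (x : Point) : ℂ :=
  along mVec ξ x - p * beta x * ξ x + q * starRingEnd ℂ (beta' x) * ξ x

/-- The GHP operator `þ'` on scalars of weight `(p, q)`; the result has weight `(p-1, q-1)`. -/
def thorn' (M : ℝ) (p q : ℤ) (ξ : Point → ℂ) (x : Point) : ℂ :=
  along (nVec M) ξ x + p * eps' M x * ξ x + q * starRingEnd ℂ (eps' M x) * ξ x

/-- The GHP operator `ð'` on scalars of weight `(p, q)`; the result has weight `(p-1, q+1)`. -/
def eth' (p q : ℤ) (ξ : Point → ℂ) (x : Point) : ℂ :=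
  along mbarVec ξ x + p * beta' x * ξ x - q * starRingEnd ℂ (beta x) * ξ x

/-! ## Hertz potentials and the perturbations they generate -/

/-- `η = (þ + 3ρ) ψ`, of weight `(-3, 1)`, for `ψ` of weight `(-4, 0)`. -/
def etaOf (M : ℝ) (ψ : Point → ℂ) (x : Point) : ℂ := thorn M (-4) 0 ψ x + 3 * rho M x * ψ x

/-- The spin-`(-2)` Teukolsky operator
`𝒪† ψ = [(þ' - ρ̄')(þ + 3ρ) - ð'ð - 3Ψ₂] ψ` on `ψ` of weight `(-4, 0)`. -/
def teukolskyAdj (M : ℝ) (ψ : Point → ℂ) (x : Point) : ℂ :=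
  (thorn' M (-3) 1 (etaOf M ψ) x - starRingEnd ℂ (rho' M x) * etaOf M ψ x)
    - eth' (-3) (-1) (eth (-4) 0 ψ) x - 3 * Psi2 M x * ψ x

/-- `(t, r, θ, φ) ↦ (t, X, Y, Z)` with `(X, Y, Z)` the point of `ℝ³` with spherical coordinates
`(r, θ, φ)`. The coordinates `(t, X, Y, Z)` with `X² + Y² + Z² > (2M)²` are smooth coordinates of
the whole exterior, the axis included. -/
def toCartesian (x : Point) : Point :=
  ![x 0, x 1 * (Real.sin (x 2) * Real.cos (x 3)), x 1 * (Real.sin (x 2) * Real.sin (x 3)),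
    x 1 * Real.cos (x 2)]

/-- The components of `m^a` in the coordinates `(X, Y, Z)`. -/
def mCartesian (x : Point) : Fin 3 → ℂ := fun i =>
  ((1 / √2 : ℝ) : ℂ) *
    ((((![Real.cos (x 2) * Real.cos (x 3), Real.cos (x 2) * Real.sin (x 3), -Real.sin (x 2)] :
        Fin 3 → ℝ) i : ℝ) : ℂ)
      + Complex.I * (((![-Real.sin (x 3), Real.cos (x 3), 0] : Fin 3 → ℝ) i : ℝ) : ℂ))

/-- A smooth Hertz potential on the exterior, given by its component `ψ` of GHP weight `(-4, 0)` in
the Carter frame. Since the frame is singular at the axis, smoothness of the weighted scalar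
there (and `2π`-periodicity in `φ`) says that the tensor `ψ m^a m^b`, which does not change under
rotations of `m`, is a smooth tensor field on the whole exterior. -/
structure IsHertzPotential (M : ℝ) (ψ : Point → ℂ) : Prop where
  smooth : ContDiffOn ℝ ∞ ψ (exterior M)
  smooth_axis : ∃ F : Point → Fin 3 → Fin 3 → ℂ,
    ContDiffOn ℝ ∞ F {y | (2 * M) ^ 2 < y 1 ^ 2 + y 2 ^ 2 + y 3 ^ 2} ∧
    ∀ x ∈ exterior M, ∀ i j, F (toCartesian x) i j = ψ x * mCartesian x i * mCartesian x j
  teukolsky : ∀ x ∈ exterior M, teukolskyAdj M ψ x = 0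

/-- `U = ð² ψ`. -/
def hertzU (ψ : Point → ℂ) : Point → ℂ := eth (-3) (-1) (eth (-4) 0 ψ)

/-- `V = [þ ð + ð (þ + 3ρ)] ψ`. -/
def hertzV (M : ℝ) (ψ : Point → ℂ) (x : Point) : ℂ :=
  thorn M (-3) (-1) (eth (-4) 0 ψ) x + eth (-3) 1 (etaOf M ψ) x

/-- `W = (þ - ρ)(þ + 3ρ) ψ`. -/
def hertzW (M : ℝ) (ψ : Point → ℂ) (x : Point) : ℂ :=
  thorn M (-3) 1 (etaOf M ψ) x - rho M x * etaOf M ψ x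

/-- The complex metric perturbation `γ_{ab} = (𝒮† ψ)_{ab} = - l_a l_b U + l_{(a} m_{b)} V - m_a m_b W`
generated by the Hertz potential `ψ`. -/
def hertzPert (M : ℝ) (ψ : Point → ℂ) : Tensor2 := fun x a b =>
  let l := lower M x (lVec M x)
  let m := lower M x (mVec x)
  (1 / 2) * (l a * m b + m a * l b) * hertzV M ψ x - l a * l b * hertzU ψ x
    - m a * m b * hertzW M ψ x

/-- The real part of a perturbation. -/
def rePert (γ : Tensor2) : Tensor2 := fun x a b => ((γ x a b).re : ℂ)

/-- The imaginary part of a perturbation. -/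
def imPert (γ : Tensor2) : Tensor2 := fun x a b => ((γ x a b).im : ℂ)

/-- The complex conjugate of a perturbation. -/
def conjPert (γ : Tensor2) : Tensor2 := fun x a b => starRingEnd ℂ (γ x a b)

/-- The Lie derivative along the Killing field `∂_t`, a coordinate vector field. -/
def lieT (γ : Tensor2) : Tensor2 := fun x a b => pd 0 (fun y => γ y a b) x

/-! ## The symplectic product and the canonical energy -/

/-- The tensor `P^{abcdef}` of the symplectic current. -/
def symplP (M : ℝ) (x : Point) (a b c d e f : Fin 4) : ℝ :=
  let g := metricInv M x
  g a e * g f b * g c d - (1 / 2) * g a d * g b e * g f c - (1 / 2) * g a b * g c d * g e f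
    - (1 / 2) * g b c * g a e * g f d + (1 / 2) * g b c * g a d * g e f

/-- The symplectic current `w^a = P^{abcdef} (γ'_{bc} ∇_d γ_{ef} - γ_{bc} ∇_d γ'_{ef})`, complex
linear in each of `γ` and `γ'`. -/
def symplCurrent (M : ℝ) (γ γ' : Tensor2) (x : Point) (a : Fin 4) : ℂ :=
  ∑ b, ∑ c, ∑ d, ∑ e, ∑ f, (symplP M x a b c d e f : ℂ) *
    (γ' x b c * cov2 M γ x d e f - γ x b c * cov2 M γ' x d e f)

/-- The unit normal `u_a = (l_a + n_a) / √2` of the slices of constant `t`. -/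
def unitNormal (M : ℝ) (x : Point) (a : Fin 4) : ℂ :=
  (lower M x (lVec M x) a + lower M x (nVec M x) a) / ((√2 : ℝ) : ℂ)

/-- The volume density `√|det h|` of the induced metric on the slices of constant `t`, in the
coordinates `(r, θ, φ)`. -/
def volDensity (M : ℝ) (x : Point) : ℝ :=
  √|((metric M x).submatrix (Fin.succ : Fin 3 → Fin 4) (Fin.succ : Fin 3 → Fin 4)).det|

/-- The range of the coordinates `(r, θ, φ)` on a slice of constant `t`, up to a null set. -/
def sliceDomain (M : ℝ) : Set (Fin 3 → ℝ) :=
  {y | 2 * M < y 0 ∧ (0 < y 1 ∧ y 1 < Real.pi) ∧ (0 < y 2 ∧ y 2 < 2 * Real.pi)}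

/-- The integrand `u_a w^a √|det h|` of the symplectic product on the slice `t = τ`. -/
def symplDensity (M τ : ℝ) (γ γ' : Tensor2) (y : Fin 3 → ℝ) : ℂ :=
  let x : Point := Fin.cons τ y
  (∑ a, unitNormal M x a * symplCurrent M γ γ' x a) * (volDensity M x : ℂ)

/-- The integral that defines `Ω(γ, γ')` on the slice `t = τ` converges. -/
def OmegaConverges (M τ : ℝ) (γ γ' : Tensor2) : Prop :=
  MeasureTheory.IntegrableOn (symplDensity M τ γ γ') (sliceDomain M)

/-- The symplectic product `Ω(γ, γ') = ∫_Σ u_a w^a(γ, γ')` on the Cauchy surface `Σ = {t = τ}`. -/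
def Omega (M τ : ℝ) (γ γ' : Tensor2) : ℂ :=
  ∫ y in sliceDomain M, symplDensity M τ γ γ' y

/-- The integral that defines the canonical energy of `γ` converges. -/
def EnergyConverges (M τ : ℝ) (γ : Tensor2) : Prop :=
  OmegaConverges M τ (conjPert γ) (lieT γ)

/-- The canonical energy `𝓔(γ) = Ω(γ̄, £_t γ)`; for real `γ` it is `Ω(γ, £_t γ)`. -/
def energy (M τ : ℝ) (γ : Tensor2) : ℂ := Omega M τ (conjPert γ) (lieT γ)

/-! ## The perturbed Weyl scalar `ψ₀` -/

/-- The background curvature `R_{abc}{}^d`. -/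
def riemann (M : ℝ) (x : Point) (a b c d : Fin 4) : ℝ :=
  pd b (christoffel M d a c) x - pd a (christoffel M d b c) x
    + ∑ e, (christoffel M e a c x * christoffel M d e b x
      - christoffel M e b c x * christoffel M d e a x)

/-- The perturbed connection, with its upper index lowered by the background metric:
`S_{dbc} = (∇_b γ_{dc} + ∇_c γ_{bd} - ∇_d γ_{bc}) / 2`. -/
def linConn (M : ℝ) (γ : Tensor2) (x : Point) (d b c : Fin 4) : ℂ :=
  (1 / 2) * (cov2 M γ x b d c + cov2 M γ x c b d - cov2 M γ x d b c)

/-- `g_{de} (δR)_{abc}{}^e`, where `(δR)_{abc}{}^d` is the perturbation of `R_{abc}{}^d`. -/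
def linRiemannMixed (M : ℝ) (γ : Tensor2) (x : Point) (a b c d : Fin 4) : ℂ :=
  cov3 M (linConn M γ) x b d a c - cov3 M (linConn M γ) x a d b c

/-- The perturbation of `R_{abcd} = g_{de} R_{abc}{}^e`. -/
def linRiemann (M : ℝ) (γ : Tensor2) (x : Point) (a b c d : Fin 4) : ℂ :=
  linRiemannMixed M γ x a b c d + ∑ e, γ x d e * (riemann M x a b c e : ℂ)

/-- The perturbation of the Ricci tensor `R_{ac} = R_{abc}{}^b`. -/
def linRicci (M : ℝ) (γ : Tensor2) (x : Point) (a c : Fin 4) : ℂ :=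
  ∑ b, ∑ d, (metricInv M x b d : ℂ) * linRiemannMixed M γ x a b c d

/-- The perturbation of the scalar curvature (the background is Ricci flat). -/
def linScalar (M : ℝ) (γ : Tensor2) (x : Point) : ℂ :=
  ∑ a, ∑ c, (metricInv M x a c : ℂ) * linRicci M γ x a c

/-- The perturbation of the Weyl tensor
`C_{abcd} = R_{abcd} - (g_{a[c} R_{d]b} - g_{b[c} R_{d]a}) + (1/3) R g_{a[c} g_{d]b}`
(the background is Ricci flat). -/
def linWeyl (M : ℝ) (γ : Tensor2) (x : Point) (a b c d : Fin 4) : ℂ :=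
  let g : Fin 4 → Fin 4 → ℂ := fun i j => (metric M x i j : ℂ)
  let Ric := linRicci M γ x
  linRiemann M γ x a b c d
    - ((1 / 2) * (g a c * Ric d b - g a d * Ric c b)
      - (1 / 2) * (g b c * Ric d a - g b d * Ric c a))
    + (1 / 3) * linScalar M γ x * ((1 / 2) * (g a c * g d b - g a d * g c b))

/-- The operator `𝒯`: the perturbation of `Ψ₀ = - C_{abcd} l^a m^b l^c m^d`. The perturbation of the
frame does not contribute, because `Ψ₀ = Ψ₁ = 0` and `R_{ab} = 0` in the background. -/
def weylT (M : ℝ) (γ : Tensor2) (x : Point) : ℂ :=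
  -∑ a, ∑ b, ∑ c, ∑ d,
    linWeyl M γ x a b c d * lVec M x a * mVec x b * lVec M x c * mVec x d

end Schwarzschild

end

/-! The perturbation $\gamma=\mathcal S^\dagger[\psi]$ is a symmetric tensor built only from $l_a$
and $m_a$. Let $N$ be the complex 2-plane spanned by $l$ and $m$. Two facts about $N$ carry the
proof. It is totally null (`metric_nullVec`), so $\gamma$ is trace-free and $\gamma(k,\cdot)=0$ for
$k\in N$. It is parallel along itself, $\nabla_k k'\in N$ for sections $k,k'$ of $N$
(`covVec_nullVec`).

Differentiating $\gamma_{ef}k^f=0$ along $N$ then gives $j^d k^f\nabla_d\gamma_{ef}=0$ for $j,k\in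
N$ with $e$ free (`IsNullPert.cov2_contract_contract`). In the symplectic current of two such
perturbations every term contains a contraction of this kind, a contraction of $\gamma$ with $N$, or
a trace, so the current is zero pointwise (`IsNullPert.symplCurrent_eq_zero`). Hence
$\Omega(\gamma,\gamma')=0$, with integrand zero.

Since $\partial_t$ preserves $N$, also $w(\gamma,\mathcal L_t\gamma)=0$. As $w$ is bilinear with
real coefficients, the real part of this identity says that the energy densities of
$\operatorname{Re}\gamma$ and $\operatorname{Im}\gamma$ agree pointwise; this gives both the
equivalence of convergence and the equality.

For $\mathcal T[\gamma]$, the linearized connection vanishes when all three slots lie in $N$. By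
Leibniz and parallelism of $N$ so does its covariant derivative on four vectors of $N$, hence the
linearized Riemann tensor. The Ricci and scalar corrections in the Weyl tensor carry a factor
$g|_N=0$. All of this is collected for the class `IsNullPert`, to which `isNullPert_hertzPert` shows
that $\gamma$ belongs. -/

noncomputable section

namespace Schwarzschild

/-! ### Calculus of coordinate derivatives. -/

section PartialDerivatives

variable {E : Type*} [NormedAddCommGroup E] [NormedSpace ℝ E]

theorem pd_congr {f g : Point → E} {x : Point} (h : f =ᶠ[nhds x] g) (a : Fin 4) :
    pd a f x = pd a g x := by
  unfold pd; rw [h.fderiv_eq]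

theorem pd_const (a : Fin 4) (c : E) (x : Point) : pd a (fun _ => c) x = 0 := by
  simp [pd]

theorem pd_neg (f : Point → E) (x : Point) (a : Fin 4) :
    pd a (fun y => -f y) x = -pd a f x := by
  unfold pd; rw [fderiv_fun_neg]; rfl

theorem pd_sum {ι : Type*} (s : Finset ι) {f : ι → Point → E} {x : Point}
    (hf : ∀ i ∈ s, DifferentiableAt ℝ (f i) x) (a : Fin 4) :
    pd a (fun y => ∑ i ∈ s, f i y) x = ∑ i ∈ s, pd a (f i) x := by
  unfold pd; rw [fderiv_fun_sum hf]; simp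

theorem pd_mul {𝕜 : Type*} [NormedCommRing 𝕜] [NormedAlgebra ℝ 𝕜] {f g : Point → 𝕜} {x : Point}
    (hf : DifferentiableAt ℝ f x) (hg : DifferentiableAt ℝ g x) (a : Fin 4) :
    pd a (fun y => f y * g y) x = pd a f x * g x + f x * pd a g x := by
  unfold pd; rw [fderiv_fun_mul hf hg]; simp; ring

theorem pd_clm {F : Type*} [NormedAddCommGroup F] [NormedSpace ℝ F] (L : E →L[ℝ] F)
    {f : Point → E} {x : Point} (hf : DifferentiableAt ℝ f x) (a : Fin 4) :
    pd a (fun y => L (f y)) x = L (pd a f x) := by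
  unfold pd
  have := (L.hasFDerivAt.comp x hf.hasFDerivAt).fderiv
  rw [show (fun y => L (f y)) = L ∘ f from rfl, this]; rfl

/-- The partial derivatives of a function of one coordinate. -/
theorem pd_coord {f : ℝ → E} {f' : E} {k : Fin 4} {x : Point} (h : HasDerivAt f f' (x k))
    (a : Fin 4) : pd a (fun y => f (y k)) x = if a = k then f' else 0 := by
  have h1 : HasFDerivAt (fun y : Point => f (y k)) _ x :=
    h.hasFDerivAt.comp x (hasFDerivAt_apply (𝕜 := ℝ) k x)
  unfold pd
  rw [h1.fderiv]
  by_cases hk : a = k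
  · subst hk; simp
  · simp [hk]

end PartialDerivatives

/-! ### The Schwarzschild background: inverse metric and Christoffel symbols. -/

theorem isOpen_exterior (M : ℝ) : IsOpen (exterior M) := by
  have h1 : Continuous fun x : Point => x 1 := continuous_apply 1
  have h2 : Continuous fun x : Point => x 2 := continuous_apply 2
  exact (isOpen_lt continuous_const h1).inter
    ((isOpen_lt continuous_const h2).inter (isOpen_lt h2 continuous_const))

theorem exterior_mem_nhds {M : ℝ} {x : Point} (hx : x ∈ exterior M) : exterior M ∈ nhds x :=
  (isOpen_exterior M).mem_nhds hx

section Background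

variable {M : ℝ} {x : Point}

theorem radius_pos (hM : 0 < M) (hx : x ∈ exterior M) : 0 < x 1 := by
  have := hx.1; linarith

theorem radius_sub_pos (hx : x ∈ exterior M) : 0 < x 1 - 2 * M := by
  have := hx.1; linarith

theorem sin_pos (hx : x ∈ exterior M) : 0 < Real.sin (x 2) :=
  Real.sin_pos_of_pos_of_lt_pi hx.2.1 hx.2.2

theorem Delta_pos (hM : 0 < M) (hx : x ∈ exterior M) : 0 < Delta M x :=
  mul_pos (radius_pos hM hx) (radius_sub_pos hx)

/-- The diagonal entries of the inverse metric. -/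
def invDiag (M : ℝ) (x : Point) : Fin 4 → ℝ :=
  ![x 1 / (x 1 - 2 * M), -((x 1 - 2 * M) / x 1), -(1 / x 1 ^ 2),
    -(1 / (x 1 ^ 2 * Real.sin (x 2) ^ 2))]

theorem metricInv_eq (hM : 0 < M) (hx : x ∈ exterior M) :
    metricInv M x = Matrix.diagonal (invDiag M x) := by
  have hr := (radius_pos hM hx).ne'
  have hf := (radius_sub_pos hx).ne'
  have hs := (sin_pos hx).ne'
  unfold metricInv metric
  refine Matrix.inv_eq_right_inv ?_
  rw [Matrix.diagonal_mul_diagonal, ← Matrix.diagonal_one]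
  congr 1
  funext i
  fin_cases i <;> simp [invDiag, Delta] <;> field_simp

/-- The partial derivatives `∂_a g_{kk}` of the diagonal entries of the metric. -/
def metricDeriv (M : ℝ) (x : Point) : Fin 4 → Fin 4 → ℝ :=
  ![0, ![2 * M / x 1 ^ 2, 2 * M / (x 1 - 2 * M) ^ 2, -(2 * x 1), -(2 * x 1 * Real.sin (x 2) ^ 2)],
    ![0, 0, 0, -(x 1 ^ 2 * (2 * Real.sin (x 2) * Real.cos (x 2)))], 0]

theorem pd_metric_diag (hM : 0 < M) (hx : x ∈ exterior M) (a k : Fin 4) :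
    pd a (fun y => metric M y k k) x = metricDeriv M x a k := by
  have hr := (radius_pos hM hx).ne'
  have hf := (radius_sub_pos hx).ne'
  have hid : HasDerivAt (fun r : ℝ => r) 1 (x 1) := hasDerivAt_id _
  have hsq : HasDerivAt (fun r : ℝ => r ^ 2) (2 * x 1) (x 1) := by
    simpa using hid.fun_pow 2
  have hD : HasDerivAt (fun r : ℝ => r * (r - 2 * M)) (1 * (x 1 - 2 * M) + x 1 * 1) (x 1) :=
    hid.mul (hid.sub_const _)
  have h0 := hD.div hsq (pow_ne_zero 2 hr)
  have h1 := (hsq.div hD (mul_ne_zero hr hf)).neg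
  have hs : HasDerivAt (fun t : ℝ => Real.sin t ^ 2) (2 * Real.sin (x 2) * Real.cos (x 2)) (x 2) := by
    simpa using (Real.hasDerivAt_sin (x 2)).fun_pow 2
  have e0 := pd_coord h0 a
  have e1 := pd_coord h1 a
  have e2 := pd_coord hsq.neg a
  have e3 : pd a (fun y : Point => -(y 1 ^ 2 * Real.sin (y 2) ^ 2)) x
      = -((if a = 1 then 2 * x 1 else 0) * Real.sin (x 2) ^ 2
        + x 1 ^ 2 * (if a = 2 then 2 * Real.sin (x 2) * Real.cos (x 2) else 0)) := by
    rw [pd_neg, pd_mul (by fun_prop) (by fun_prop), pd_coord hsq, pd_coord hs]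
  fin_cases k
  · refine Eq.trans e0 ?_
    fin_cases a <;> simp [metricDeriv]
    field_simp; ring
  · refine Eq.trans e1 ?_
    fin_cases a <;> simp [metricDeriv]
    field_simp; ring
  · refine Eq.trans e2 ?_
    fin_cases a <;> simp [metricDeriv]
  · refine Eq.trans e3 ?_
    fin_cases a <;> simp [metricDeriv]

theorem pd_metric (hM : 0 < M) (hx : x ∈ exterior M) (a b c : Fin 4) :
    pd a (fun y => metric M y b c) x = if b = c then metricDeriv M x a b else 0 := by
  by_cases h : b = c
  · subst h; simpa using pd_metric_diag hM hx a b
  · simp only [h, if_false]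
    have : (fun y => metric M y b c) = fun _ => 0 := by
      funext y; exact Matrix.diagonal_apply_ne _ h
    rw [this, pd_const]

/-- The Christoffel symbols of the Schwarzschild metric in closed form. -/
def chr (M : ℝ) (x : Point) : Fin 4 → Fin 4 → Fin 4 → ℝ :=
  ![![![0, M / (x 1 * (x 1 - 2 * M)), 0, 0], ![M / (x 1 * (x 1 - 2 * M)), 0, 0, 0], 0, 0],
    ![![M * (x 1 - 2 * M) / x 1 ^ 3, 0, 0, 0], ![0, -(M / (x 1 * (x 1 - 2 * M))), 0, 0],
      ![0, 0, -(x 1 - 2 * M), 0], ![0, 0, 0, -((x 1 - 2 * M) * Real.sin (x 2) ^ 2)]],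
    ![0, ![0, 0, 1 / x 1, 0], ![0, 1 / x 1, 0, 0],
      ![0, 0, 0, -(Real.sin (x 2) * Real.cos (x 2))]],
    ![0, ![0, 0, 0, 1 / x 1], ![0, 0, 0, Real.cos (x 2) / Real.sin (x 2)],
      ![0, 1 / x 1, Real.cos (x 2) / Real.sin (x 2), 0]]]

theorem christoffel_eq (hM : 0 < M) (hx : x ∈ exterior M) (a b c : Fin 4) :
    christoffel M a b c x = chr M x a b c := by
  have hr := (radius_pos hM hx).ne'
  have hf := (radius_sub_pos hx).ne'
  have hs := (sin_pos hx).ne'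
  unfold christoffel
  rw [metricInv_eq hM hx]
  simp only [Matrix.diagonal_apply, ite_mul, zero_mul, Finset.sum_ite_eq, Finset.mem_univ, if_true,
    pd_metric hM hx]
  fin_cases a <;> fin_cases b <;> fin_cases c <;> 
    (simp [metricDeriv, chr, invDiag]; try field_simp; try ring)

/-- The diagonal part of $\nabla_c g^{ef}=0$: for a diagonal metric the two Christoffel terms
coincide, hence the factor 2. -/
theorem pd_invDiag (hM : 0 < M) (hx : x ∈ exterior M) (c e : Fin 4) :
    pd c (fun y => invDiag M y e) x = -(2 * chr M x e c e * invDiag M x e) := by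
  have hr := (radius_pos hM hx).ne'
  have hf := (radius_sub_pos hx).ne'
  have hs := (sin_pos hx).ne'
  have hid : HasDerivAt (fun r : ℝ => r) 1 (x 1) := hasDerivAt_id _
  have h0 := hid.div (hid.sub_const (2 * M)) hf
  have h1 := ((hid.sub_const (2 * M)).div hid hr).neg
  have hsq : HasDerivAt (fun r : ℝ => r ^ 2) (2 * x 1) (x 1) := by
    simpa using hid.fun_pow 2
  have h2 := ((hasDerivAt_const (x 1) (1 : ℝ)).div hsq (pow_ne_zero 2 hr))
  have hs2 : HasDerivAt (fun t : ℝ => Real.sin t ^ 2) (2 * Real.sin (x 2) * Real.cos (x 2)) (x 2) := by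
    simpa using (Real.hasDerivAt_sin (x 2)).fun_pow 2
  have h3 := ((hasDerivAt_const (x 2) (1 : ℝ)).div hs2 (pow_ne_zero 2 hs))
  have e0 := pd_coord h0 c
  have e1 := pd_coord h1 c
  have e2 := pd_coord h2.neg c
  -- The entry $g^{\phi\phi}$ depends on two coordinates; it is split into a product of functions of
  -- one coordinate each, so that `pd_coord` applies to the factors.
  have d2 : DifferentiableAt ℝ (fun y : Point => 1 / y 1 ^ 2) x :=
    DifferentiableAt.comp (𝕜 := ℝ) x (g := fun r : ℝ => 1 / r ^ 2) (f := fun y : Point => y 1)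
      h2.differentiableAt (by fun_prop)
  have d3 : DifferentiableAt ℝ (fun y : Point => 1 / Real.sin (y 2) ^ 2) x :=
    DifferentiableAt.comp (𝕜 := ℝ) x (g := fun r : ℝ => 1 / Real.sin r ^ 2)
      (f := fun y : Point => y 2) h3.differentiableAt (by fun_prop)
  have e3 := pd_mul d2 d3 c
  have e2' := pd_coord h2 c
  have e3' := pd_coord h3 c
  simp only [Pi.div_apply] at e2' e3'
  rw [e2', e3'] at e3
  fin_cases e
  · refine Eq.trans e0 ?_
    fin_cases c <;> simp [chr, invDiag]
    field_simp
  · refine Eq.trans e1 ?_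
    fin_cases c <;> simp [chr, invDiag]
    field_simp
  · refine Eq.trans e2 ?_
    fin_cases c <;> simp [chr, invDiag]
    field_simp
  · refine Eq.trans (b := -pd c (fun y : Point => 1 / y 1 ^ 2 * (1 / Real.sin (y 2) ^ 2)) x) ?_ ?_
    · rw [← pd_neg]; congr 1; funext y; simp [invDiag]; ring
    · rw [e3]
      fin_cases c <;> simp [chr, invDiag] <;> field_simp

/-- The off-diagonal part of $\nabla_c g^{ef}=0$: there $g^{ef}$ is identically zero and only the
Christoffel terms remain. -/
theorem chr_mul_invDiag (hM : 0 < M) (hx : x ∈ exterior M) {e f : Fin 4} (hef : e ≠ f)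
    (c : Fin 4) : chr M x e c f * invDiag M x f + chr M x f c e * invDiag M x e = 0 := by
  have hr := (radius_pos hM hx).ne'
  have hf := (radius_sub_pos hx).ne'
  have hs := (sin_pos hx).ne'
  fin_cases e <;> fin_cases f <;> fin_cases c <;>
    first
    | exact absurd rfl hef
    | (simp [chr, invDiag]; try field_simp; try ring)

end Background

/-! ### The null plane of $l$ and $m$, and Leibniz rules for contractions. -/

/-- Vector fields spanning the totally null plane of `l` and `m`: they are proportional to `l` and
`m`. -/
def nullVec (M : ℝ) (i : Fin 2) (x : Point) : Fin 4 → ℂ :=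
  (![![((x 1 / (x 1 - 2 * M) : ℝ) : ℂ), 1, 0, 0],
    ![0, 0, 1, Complex.I * ((1 / Real.sin (x 2) : ℝ) : ℂ)]] : Fin 2 → Fin 4 → ℂ) i

/-- The covariant derivative `∇_d v^e` of a vector field. -/
def covVec (M : ℝ) (v : Point → Fin 4 → ℂ) (x : Point) (d e : Fin 4) : ℂ :=
  pd d (fun y => v y e) x + ∑ f, (christoffel M e d f x : ℂ) * v x f

/-- The covariant derivative `∇_d U_e` of a covector field. -/
def cov1 (M : ℝ) (U : Point → Fin 4 → ℂ) (x : Point) (d e : Fin 4) : ℂ :=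
  pd d (fun y => U y e) x - ∑ k, (christoffel M k d e x : ℂ) * U x k

section

variable {M : ℝ} {x : Point}

theorem contDiffOn_nullVec (M : ℝ) (i : Fin 2) (a : Fin 4) :
    ContDiffOn ℝ ∞ (fun y => nullVec M i y a) (exterior M) := by
  have h0 : ContDiffOn ℝ ∞ (fun y : Point => y 1 / (y 1 - 2 * M)) (exterior M) :=
    ContDiffOn.div (by fun_prop) (by fun_prop) fun y hy => (radius_sub_pos hy).ne'
  have h1 : ContDiffOn ℝ ∞ (fun y : Point => 1 / Real.sin (y 2)) (exterior M) :=
    ContDiffOn.div (by fun_prop) (by fun_prop) fun y hy => (sin_pos hy).ne'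
  have h0' := Complex.ofRealCLM.contDiff.comp_contDiffOn h0
  have h1' := (contDiffOn_const (c := Complex.I)).mul (Complex.ofRealCLM.contDiff.comp_contDiffOn h1)
  fin_cases i <;> fin_cases a
  · exact h0'
  · exact contDiffOn_const
  · exact contDiffOn_const
  · exact contDiffOn_const
  · exact contDiffOn_const
  · exact contDiffOn_const
  · exact contDiffOn_const
  · exact h1'

theorem differentiableAt_of_contDiffOn {E : Type*} [NormedAddCommGroup E] [NormedSpace ℝ E]
    {f : Point → E} (hf : ContDiffOn ℝ ∞ f (exterior M)) (hx : x ∈ exterior M) :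
    DifferentiableAt ℝ f x :=
  (hf.contDiffAt (exterior_mem_nhds hx)).differentiableAt (by simp)

theorem contDiffOn_pd {E : Type*} [NormedAddCommGroup E] [NormedSpace ℝ E]
    {f : Point → E} (hf : ContDiffOn ℝ ∞ f (exterior M)) (a : Fin 4) :
    ContDiffOn ℝ ∞ (pd a f) (exterior M) :=
  (hf.fderiv_of_isOpen (isOpen_exterior M) (by simp)).clm_apply contDiffOn_const

theorem pd_nullVec (hx : x ∈ exterior M) (i : Fin 2) (a d : Fin 4) :
    pd d (fun y => nullVec M i y a) x
      = (![![![0, ((-(2 * M) / (x 1 - 2 * M) ^ 2 : ℝ) : ℂ), 0, 0], 0, 0, 0],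
          ![0, 0, 0, ![0, 0, Complex.I * ((-Real.cos (x 2) / Real.sin (x 2) ^ 2 : ℝ) : ℂ), 0]]] :
          Fin 2 → Fin 4 → Fin 4 → ℂ) i a d := by
  have hf := (radius_sub_pos hx).ne'
  have hs := (sin_pos hx).ne'
  have h0 := (((hasDerivAt_id (x 1)).div ((hasDerivAt_id (x 1)).sub_const (2 * M)) hf)).ofReal_comp
  have h1 := (((hasDerivAt_const (x 2) (1 : ℝ)).div (Real.hasDerivAt_sin (x 2)) hs).ofReal_comp).const_mul
    Complex.I
  have e0 := pd_coord h0 d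
  have e1 := pd_coord h1 d
  fin_cases i <;> fin_cases a
  · refine Eq.trans e0 ?_
    fin_cases d <;> simp
  · refine Eq.trans (pd_const d _ x) ?_
    fin_cases d <;> simp
  · refine Eq.trans (pd_const d _ x) ?_
    fin_cases d <;> simp
  · refine Eq.trans (pd_const d _ x) ?_
    fin_cases d <;> simp
  · refine Eq.trans (pd_const d _ x) ?_
    fin_cases d <;> simp
  · refine Eq.trans (pd_const d _ x) ?_
    fin_cases d <;> simp
  · refine Eq.trans (pd_const d _ x) ?_
    fin_cases d <;> simp
  · refine Eq.trans e1 ?_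
    fin_cases d <;> simp

/-- The plane spanned by `l` and `m` is parallel along itself. -/
theorem covVec_nullVec (hM : 0 < M) (hx : x ∈ exterior M) (i j : Fin 2) :
    ∃ B : ℂ, ∀ e, ∑ d, nullVec M i x d * covVec M (nullVec M j) x d e = B * nullVec M 1 x e := by
  have hr : (x 1 : ℂ) ≠ 0 := by exact_mod_cast (radius_pos hM hx).ne'
  have hf : (x 1 : ℂ) - 2 * M ≠ 0 := by exact_mod_cast (radius_sub_pos hx).ne'
  have hs : (Real.sin (x 2) : ℂ) ≠ 0 := by exact_mod_cast (sin_pos hx).ne'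
  -- With $k_0=\frac{r}{r-2M}\partial_t+\partial_r$ and
  -- $k_1=\partial_\theta+\frac{i}{\sin\theta}\partial_\phi$: $k_0$ is an affinely parametrized
  -- geodesic field, $\nabla_{k_0}k_1=\nabla_{k_1}k_0=k_1/r$ and $\nabla_{k_1}k_1=\cot\theta\,k_1$.
  refine ⟨(![![0, 1 / (x 1 : ℂ)], ![1 / (x 1 : ℂ), Real.cos (x 2) / Real.sin (x 2)]] :
    Fin 2 → Fin 2 → ℂ) i j, fun e => ?_⟩
  unfold covVec
  simp only [pd_nullVec hx, christoffel_eq hM hx, Fin.sum_univ_four]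
  have hI := Complex.I_sq
  fin_cases i <;> fin_cases j <;> fin_cases e <;>
    simp [nullVec, chr, -Complex.ofReal_sin, -Complex.ofReal_cos] <;> field_simp <;>
    (try rw [hI]) <;> ring

/-- Total nullity: $g(l,l)=g(l,m)=g(m,m)=0$ up to scale. In $g(k_0,k_0)$ the $t$ and $r$ terms
cancel, in $g(k_1,k_1)$ the $\theta$ and $\phi$ terms, through $i^2=-1$. -/
theorem metric_nullVec (hM : 0 < M) (hx : x ∈ exterior M) (i j : Fin 2) :
    ∑ a, (metric M x a a : ℂ) * nullVec M i x a * nullVec M j x a = 0 := by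
  have hr : (x 1 : ℂ) ≠ 0 := by exact_mod_cast (radius_pos hM hx).ne'
  have hf : (x 1 : ℂ) - 2 * M ≠ 0 := by exact_mod_cast (radius_sub_pos hx).ne'
  have hs : (Real.sin (x 2) : ℂ) ≠ 0 := by exact_mod_cast (sin_pos hx).ne'
  have hI := Complex.I_sq
  simp only [Fin.sum_univ_four]
  fin_cases i <;> fin_cases j <;>
    simp [nullVec, metric, Delta, -Complex.ofReal_sin] <;> field_simp <;>
    (try rw [hI]) <;> ring

theorem pd_contract {U v : Point → Fin 4 → ℂ} (hU : ∀ e, DifferentiableAt ℝ (fun y => U y e) x)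
    (hv : ∀ e, DifferentiableAt ℝ (fun y => v y e) x) (d : Fin 4) :
    pd d (fun y => ∑ e, U y e * v y e) x
      = ∑ e, (pd d (fun y => U y e) x * v x e + U x e * pd d (fun y => v y e) x) := by
  rw [pd_sum _ fun e _ => (hU e).fun_mul (hv e)]
  exact Finset.sum_congr rfl fun e _ => pd_mul (hU e) (hv e) d

/-- The Leibniz rule; the Christoffel terms of the covector and of the vector cancel. The versions
for two and three slots peel off one slot at a time. -/
theorem cov1_contract {U v : Point → Fin 4 → ℂ} (hU : ∀ e, DifferentiableAt ℝ (fun y => U y e) x)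
    (hv : ∀ e, DifferentiableAt ℝ (fun y => v y e) x) (d : Fin 4) :
    ∑ e, cov1 M U x d e * v x e
      = pd d (fun y => ∑ e, U y e * v y e) x - ∑ e, U x e * covVec M v x d e := by
  rw [pd_contract hU hv]
  simp only [cov1, covVec, Fin.sum_univ_four]
  ring

theorem cov2_contract {T : Tensor2} {v : Point → Fin 4 → ℂ}
    (hT : ∀ e f, DifferentiableAt ℝ (fun y => T y e f) x)
    (hv : ∀ e, DifferentiableAt ℝ (fun y => v y e) x) (d e : Fin 4) :
    ∑ f, cov2 M T x d e f * v x f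
      = cov1 M (fun y e => ∑ f, T y e f * v y f) x d e - ∑ f, T x e f * covVec M v x d f := by
  rw [cov1, pd_contract (hT e) hv]
  simp only [cov2, covVec, Fin.sum_univ_four]
  ring

theorem cov3_contract {S : Point → Fin 4 → Fin 4 → Fin 4 → ℂ} {v : Point → Fin 4 → ℂ}
    (hS : ∀ d b c, DifferentiableAt ℝ (fun y => S y d b c) x)
    (hv : ∀ e, DifferentiableAt ℝ (fun y => v y e) x) (a d b : Fin 4) :
    ∑ c, cov3 M S x a d b c * v x c
      = cov2 M (fun y d b => ∑ c, S y d b c * v y c) x a d b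
        - ∑ c, S x d b c * covVec M v x a c := by
  rw [cov2, pd_contract (hS d b) hv]
  simp only [cov3, covVec, Fin.sum_univ_four]
  ring

theorem cov3_contract_all {S : Point → Fin 4 → Fin 4 → Fin 4 → ℂ} {u v w : Point → Fin 4 → ℂ}
    (hS : ∀ d b c, DifferentiableAt ℝ (fun y => S y d b c) x)
    (hu : ∀ e, DifferentiableAt ℝ (fun y => u y e) x)
    (hv : ∀ e, DifferentiableAt ℝ (fun y => v y e) x)
    (hw : ∀ e, DifferentiableAt ℝ (fun y => w y e) x) (a : Fin 4) :
    ∑ d, (∑ b, (∑ c, cov3 M S x a d b c * w x c) * v x b) * u x d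
      = pd a (fun y => ∑ d, (∑ b, (∑ c, S y d b c * w y c) * v y b) * u y d) x
        - ∑ d, (∑ b, (∑ c, S x d b c * w x c) * v x b) * covVec M u x a d
        - ∑ d, (∑ b, (∑ c, S x d b c * w x c) * covVec M v x a b) * u x d
        - ∑ d, (∑ b, (∑ c, S x d b c * covVec M w x a c) * v x b) * u x d := by
  have h1 : ∀ d b, DifferentiableAt ℝ (fun y => ∑ c, S y d b c * w y c) x := fun d b =>
    DifferentiableAt.fun_sum fun c _ => (hS d b c).fun_mul (hw c)
  have h2 : ∀ d, DifferentiableAt ℝ (fun y => ∑ b, (∑ c, S y d b c * w y c) * v y b) x := fun d =>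
    DifferentiableAt.fun_sum fun b _ => (h1 d b).fun_mul (hv b)
  simp only [cov3_contract hS hw, sub_mul, Finset.sum_sub_distrib, cov2_contract h1 hv,
    cov1_contract h2 hu]

end

/-! ### Algebra and first derivatives of perturbations in the null plane. -/

/-- A smooth symmetric perturbation with both slots in the plane spanned by `l` and `m`. -/
def IsNullPert (M : ℝ) (γ : Tensor2) : Prop :=
  ∃ c : Fin 2 → Fin 2 → Point → ℂ, (∀ i j, ContDiffOn ℝ ∞ (c i j) (exterior M)) ∧
    c 0 1 = c 1 0 ∧
    ∀ x ∈ exterior M, ∀ a b, γ x a b = ∑ i, ∑ j,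
      c i j x * (metric M x a a * nullVec M i x a) * (metric M x b b * nullVec M j x b)

section

variable {M : ℝ} {x : Point} {γ γ' : Tensor2}

theorem contDiffOn_metric (M : ℝ) (hM : 0 < M) (a : Fin 4) :
    ContDiffOn ℝ ∞ (fun y => metric M y a a) (exterior M) := by
  have hr : ∀ y ∈ exterior M, y 1 ^ 2 ≠ 0 := fun y hy => pow_ne_zero 2 (radius_pos hM hy).ne'
  have hD : ∀ y ∈ exterior M, y 1 * (y 1 - 2 * M) ≠ 0 := fun y hy => (Delta_pos hM hy).ne'
  fin_cases a
  · exact ContDiffOn.div (f := fun y : Point => y 1 * (y 1 - 2 * M)) (g := fun y : Point => y 1 ^ 2)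
      (by fun_prop) (by fun_prop) hr
  · exact (ContDiffOn.div (g := fun y : Point => y 1 * (y 1 - 2 * M)) (f := fun y : Point => y 1 ^ 2)
      (by fun_prop) (by fun_prop) hD).neg
  · exact ContDiffOn.neg (f := fun y : Point => y 1 ^ 2) (by fun_prop)
  · exact ContDiffOn.neg (f := fun y : Point => y 1 ^ 2 * Real.sin (y 2) ^ 2) (by fun_prop)

theorem contDiffOn_invDiag (hM : 0 < M) (a : Fin 4) :
    ContDiffOn ℝ ∞ (fun y => invDiag M y a) (exterior M) := by
  have hr : ∀ y ∈ exterior M, y 1 ≠ 0 := fun y hy => (radius_pos hM hy).ne'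
  have hf : ∀ y ∈ exterior M, y 1 - 2 * M ≠ 0 := fun y hy => (radius_sub_pos hy).ne'
  have hr2 : ∀ y ∈ exterior M, y 1 ^ 2 ≠ 0 := fun y hy => pow_ne_zero 2 (hr y hy)
  have hs : ∀ y ∈ exterior M, y 1 ^ 2 * Real.sin (y 2) ^ 2 ≠ 0 := fun y hy =>
    mul_ne_zero (hr2 y hy) (pow_ne_zero 2 (sin_pos hy).ne')
  fin_cases a
  · exact ContDiffOn.div (f := fun y : Point => y 1) (g := fun y : Point => y 1 - 2 * M)
      (by fun_prop) (by fun_prop) hf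
  · exact (ContDiffOn.div (f := fun y : Point => y 1 - 2 * M) (g := fun y : Point => y 1)
      (by fun_prop) (by fun_prop) hr).neg
  · exact (ContDiffOn.div (f := fun y : Point => 1) (g := fun y : Point => y 1 ^ 2)
      (by fun_prop) (by fun_prop) hr2).neg
  · exact (ContDiffOn.div (f := fun y : Point => 1)
      (g := fun y : Point => y 1 ^ 2 * Real.sin (y 2) ^ 2) (by fun_prop) (by fun_prop) hs).neg

theorem invDiag_mul_metric (hM : 0 < M) (hx : x ∈ exterior M) (a : Fin 4) :
    (invDiag M x a : ℂ) * metric M x a a = 1 := by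
  have hr := (radius_pos hM hx).ne'
  have hf := (radius_sub_pos hx).ne'
  have hs := (sin_pos hx).ne'
  have : invDiag M x a * metric M x a a = 1 := by
    fin_cases a <;> simp [invDiag, metric, Delta] <;> field_simp
  exact_mod_cast this

theorem contDiffOn_metric_nullVec (hM : 0 < M) (i : Fin 2) (a : Fin 4) :
    ContDiffOn ℝ ∞ (fun y => (metric M y a a : ℂ) * nullVec M i y a) (exterior M) :=
  (Complex.ofRealCLM.contDiff.comp_contDiffOn (contDiffOn_metric M hM a)).mul
    (contDiffOn_nullVec M i a)

theorem IsNullPert.contDiffOn (hM : 0 < M) (h : IsNullPert M γ) (a b : Fin 4) :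
    ContDiffOn ℝ ∞ (fun y => γ y a b) (exterior M) := by
  obtain ⟨c, hc, -, he⟩ := h
  refine ContDiffOn.congr ?_ fun y hy => he y hy a b
  exact ContDiffOn.sum fun i _ => ContDiffOn.sum fun j _ =>
    ((hc i j).mul (contDiffOn_metric_nullVec hM i a)).mul (contDiffOn_metric_nullVec hM j b)

theorem IsNullPert.differentiableAt (hM : 0 < M) (h : IsNullPert M γ) (hx : x ∈ exterior M)
    (a b : Fin 4) : DifferentiableAt ℝ (fun y => γ y a b) x :=
  differentiableAt_of_contDiffOn (h.contDiffOn hM a b) hx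

theorem differentiableAt_nullVec (hx : x ∈ exterior M) (i : Fin 2) (a : Fin 4) :
    DifferentiableAt ℝ (fun y => nullVec M i y a) x :=
  differentiableAt_of_contDiffOn (contDiffOn_nullVec M i a) hx

theorem IsNullPert.symm (h : IsNullPert M γ) (hx : x ∈ exterior M) (a b : Fin 4) :
    γ x a b = γ x b a := by
  obtain ⟨c, -, hc, he⟩ := h
  rw [he x hx, he x hx]
  simp only [Fin.sum_univ_two, hc]
  ring

/-- The slots of $\gamma$ are lowered vectors of the plane, and the plane is orthogonal to itself.
-/
theorem IsNullPert.contract (hM : 0 < M) (h : IsNullPert M γ) (hx : x ∈ exterior M) (j : Fin 2)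
    (a : Fin 4) : ∑ b, γ x a b * nullVec M j x b = 0 := by
  obtain ⟨c, -, -, he⟩ := h
  have h0 := metric_nullVec hM hx 0 j
  have h1 := metric_nullVec hM hx 1 j
  simp only [he x hx, Fin.sum_univ_two, Fin.sum_univ_four] at h0 h1 ⊢
  linear_combination
    (c 0 0 x * (metric M x a a * nullVec M 0 x a) + c 1 0 x * (metric M x a a * nullVec M 1 x a)) * h0
    + (c 0 1 x * (metric M x a a * nullVec M 0 x a)
      + c 1 1 x * (metric M x a a * nullVec M 1 x a)) * h1

/-- The metric and the spanning fields do not depend on $t$, so $\partial_t$ acts on the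
coefficients alone. -/
theorem IsNullPert.lieT (hM : 0 < M) (h : IsNullPert M γ) : IsNullPert M (lieT γ) := by
  obtain ⟨c, hc, hs, he⟩ := h
  refine ⟨fun i j => pd 0 (c i j), fun i j => contDiffOn_pd (hc i j) 0, ?_, fun x hx a b => ?_⟩
  · simp only [hs]
  have hk : ∀ i a, pd 0 (fun y => (metric M y a a : ℂ) * nullVec M i y a) x = 0 := fun i a => by
    rw [pd_mul (f := fun y => (metric M y a a : ℂ))
      (differentiableAt_of_contDiffOn
        (Complex.ofRealCLM.contDiff.comp_contDiffOn (contDiffOn_metric M hM a)) hx)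
      (differentiableAt_nullVec hx i a)]
    have h1 : pd 0 (fun y => (metric M y a a : ℂ)) x = ((pd 0 (fun y => metric M y a a) x : ℝ) : ℂ) :=
      pd_clm Complex.ofRealCLM (differentiableAt_of_contDiffOn (contDiffOn_metric M hM a) hx) 0
    rw [h1, pd_metric_diag hM hx, pd_nullVec hx]
    fin_cases i <;> fin_cases a <;> simp [metricDeriv]
  have hd := fun i a => differentiableAt_of_contDiffOn (contDiffOn_metric_nullVec hM i a) hx
  have hcd := fun i j => differentiableAt_of_contDiffOn (hc i j) hx
  have e : (fun y => γ y a b) =ᶠ[nhds x] fun y => ∑ i, ∑ j,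
      c i j y * (metric M y a a * nullVec M i y a) * (metric M y b b * nullVec M j y b) := by
    filter_upwards [exterior_mem_nhds hx] with y hy using he y hy a b
  rw [Schwarzschild.lieT, pd_congr e,
    pd_sum _ fun i _ => DifferentiableAt.fun_sum fun j _ => ((hcd i j).fun_mul (hd i a)).fun_mul (hd j b)]
  refine Finset.sum_congr rfl fun i _ => ?_
  rw [pd_sum _ fun j _ => ((hcd i j).fun_mul (hd i a)).fun_mul (hd j b)]
  refine Finset.sum_congr rfl fun j _ => ?_
  rw [pd_mul ((hcd i j).fun_mul (hd i a)) (hd j b), pd_mul (hcd i j) (hd i a), hk, hk]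
  ring

/-- `γ^{ab}` is a combination of products of `l` and `m`. -/
theorem IsNullPert.raise (hM : 0 < M) (h : IsNullPert M γ) (hx : x ∈ exterior M) :
    ∃ c : Fin 2 → Fin 2 → ℂ, ∀ a b, (invDiag M x a : ℂ) * invDiag M x b * γ x a b
      = ∑ i, ∑ j, c i j * nullVec M i x a * nullVec M j x b := by
  obtain ⟨c, -, -, he⟩ := h
  have hg := invDiag_mul_metric hM hx
  refine ⟨fun i j => c i j x, fun a b => ?_⟩
  rw [he x hx]
  simp only [Fin.sum_univ_two]
  linear_combination
    (c 0 0 x * nullVec M 0 x a * nullVec M 0 x b + c 0 1 x * nullVec M 0 x a * nullVec M 1 x b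
      + c 1 0 x * nullVec M 1 x a * nullVec M 0 x b + c 1 1 x * nullVec M 1 x a * nullVec M 1 x b) *
    ((invDiag M x b : ℂ) * metric M x b b * hg a + hg b)

/-- The trace is $\sum_{ij} c_{ij}\,g(k_i,k_j)$, and each product is zero. -/
theorem IsNullPert.trace (hM : 0 < M) (h : IsNullPert M γ) (hx : x ∈ exterior M) :
    ∑ a, (invDiag M x a : ℂ) * γ x a a = 0 := by
  obtain ⟨c, -, -, he⟩ := h
  have hg := invDiag_mul_metric hM hx
  have hn := metric_nullVec hM hx
  have : ∀ a, (invDiag M x a : ℂ) * γ x a a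
      = ∑ i, ∑ j, c i j x * ((metric M x a a : ℂ) * nullVec M i x a * nullVec M j x a) := fun a => by
    rw [he x hx, Finset.mul_sum]
    refine Finset.sum_congr rfl fun i _ => ?_
    rw [Finset.mul_sum]
    refine Finset.sum_congr rfl fun j _ => ?_
    linear_combination c i j x * metric M x a a * nullVec M i x a * nullVec M j x a * hg a
  simp only [this]
  rw [Finset.sum_comm]
  refine Finset.sum_eq_zero fun i _ => ?_
  rw [Finset.sum_comm]
  refine Finset.sum_eq_zero fun j _ => ?_
  rw [← Finset.mul_sum, hn, mul_zero]

/-- The identity $\gamma_{ef}k^f=0$ holds on the open exterior, so it may be differentiated; this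
moves the derivative from $\gamma$ to $k$. -/
theorem IsNullPert.cov2_contract (hM : 0 < M) (h : IsNullPert M γ) (hx : x ∈ exterior M)
    (j : Fin 2) (d e : Fin 4) :
    ∑ f, cov2 M γ x d e f * nullVec M j x f = -∑ f, γ x e f * covVec M (nullVec M j) x d f := by
  rw [Schwarzschild.cov2_contract (h.differentiableAt hM hx) (differentiableAt_nullVec hx j), cov1]
  have h0 : (fun y => ∑ f, γ y e f * nullVec M j y f) =ᶠ[nhds x] fun _ => 0 := by
    filter_upwards [exterior_mem_nhds hx] with y hy using h.contract hM hy j e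
  rw [pd_congr h0, pd_const]
  simp [h.contract hM hx]

/-- A covector that annihilates the plane annihilates $\nabla_{k_i}k_j$, which lies in the plane.
This is the form in which parallelism is used. -/
theorem sum_covVec_eq_zero (hM : 0 < M) (hx : x ∈ exterior M) {U : Fin 4 → ℂ}
    (hU : ∀ i, ∑ a, U a * nullVec M i x a = 0) (i j : Fin 2) :
    ∑ d, nullVec M i x d * ∑ e, U e * covVec M (nullVec M j) x d e = 0 := by
  obtain ⟨B, hB⟩ := covVec_nullVec hM hx i j
  calc _ = ∑ e, U e * ∑ d, nullVec M i x d * covVec M (nullVec M j) x d e := by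
        simp only [Finset.mul_sum]
        rw [Finset.sum_comm]
        exact Finset.sum_congr rfl fun e _ => Finset.sum_congr rfl fun d _ => by ring
    _ = B * ∑ e, U e * nullVec M 1 x e := by
        rw [Finset.mul_sum]
        exact Finset.sum_congr rfl fun e _ => by rw [hB]; ring
    _ = 0 := by rw [hU, mul_zero]

/-- The contraction equals $-\gamma(\cdot,\nabla_{k_i}k_j)$. It suffices that the derivative slot
and one tensor slot lie in the plane; the slot $e$ stays free. -/
theorem IsNullPert.cov2_contract_contract (hM : 0 < M) (h : IsNullPert M γ) (hx : x ∈ exterior M)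
    (i j : Fin 2) (e : Fin 4) :
    ∑ d, nullVec M i x d * ∑ f, cov2 M γ x d e f * nullVec M j x f = 0 := by
  simp only [h.cov2_contract hM hx, mul_neg, Finset.sum_neg_distrib]
  rw [sum_covVec_eq_zero hM hx (fun i => h.contract hM hx i e), neg_zero]

/-- The trace of `∇_c γ` vanishes. -/
theorem IsNullPert.cov2_trace (hM : 0 < M) (h : IsNullPert M γ) (hx : x ∈ exterior M)
    (c : Fin 4) : ∑ e, (invDiag M x e : ℂ) * cov2 M γ x c e e = 0 := by
  have hi : ∀ e, DifferentiableAt ℝ (fun y => invDiag M y e) x := fun e =>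
    differentiableAt_of_contDiffOn (contDiffOn_invDiag hM e) hx
  have hic : ∀ e, DifferentiableAt ℝ (fun y => (invDiag M y e : ℂ)) x := fun e =>
    Complex.ofRealCLM.differentiableAt.comp x (hi e)
  have hp : ∀ e, pd c (fun y => (invDiag M y e : ℂ)) x
      = -(2 * chr M x e c e * invDiag M x e) := fun e => by
    have : pd c (fun y => (invDiag M y e : ℂ)) x = ((pd c (fun y => invDiag M y e) x : ℝ) : ℂ) :=
      pd_clm Complex.ofRealCLM (hi e) c
    rw [this, pd_invDiag hM hx]
    push_cast; ring
  have h0 : (fun y => ∑ e, (invDiag M y e : ℂ) * γ y e e) =ᶠ[nhds x] fun _ => 0 := by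
    filter_upwards [exterior_mem_nhds hx] with y hy using h.trace hM hy
  have h1 := pd_congr h0 c
  rw [pd_const, pd_contract hic (fun e => h.differentiableAt hM hx e e)] at h1
  have hg : ∀ e f, e ≠ f →
      (chr M x e c f : ℂ) * invDiag M x f + chr M x f c e * invDiag M x e = 0 :=
    fun e f hef => by exact_mod_cast chr_mul_invDiag hM hx hef c
  have g01 := hg 0 1 (by decide)
  have g02 := hg 0 2 (by decide)
  have g03 := hg 0 3 (by decide)
  have g12 := hg 1 2 (by decide)
  have g13 := hg 1 3 (by decide)
  have g23 := hg 2 3 (by decide)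
  simp only [hp, cov2, christoffel_eq hM hx, Fin.sum_univ_four] at h1 ⊢
  rw [h.symm hx 1 0, h.symm hx 2 0, h.symm hx 3 0, h.symm hx 2 1, h.symm hx 3 1, h.symm hx 3 2]
  -- The derivative of the zero trace accounts for the diagonal Christoffel terms; the off-diagonal
  -- ones pair up by symmetry of $\gamma$ and cancel by metric compatibility.
  linear_combination h1 - 2 * γ x 0 1 * g01 - 2 * γ x 0 2 * g02 - 2 * γ x 0 3 * g03
    - 2 * γ x 1 2 * g12 - 2 * γ x 1 3 * g13 - 2 * γ x 2 3 * g23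

end

/-! ### Vanishing of the symplectic current. -/

section

variable {M : ℝ} {x : Point} {γ γ' : Tensor2}

/-- Since $g^{ab}$ is diagonal, each of the five terms of $P$ collapses to a double sum. -/
theorem sum_symplP (hM : 0 < M) (hx : x ∈ exterior M) (A : Fin 4 → Fin 4 → ℂ)
    (N : Fin 4 → Fin 4 → Fin 4 → ℂ) (a : Fin 4) :
    ∑ b, ∑ c, ∑ d, ∑ e, ∑ f, (symplP M x a b c d e f : ℂ) * (A b c * N d e f)
      = (∑ b, ∑ c, (invDiag M x a * invDiag M x b * invDiag M x c : ℂ) * A b c * N c a b)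
        - (1 / 2) * (∑ b, ∑ c, (invDiag M x a * invDiag M x b * invDiag M x c : ℂ) * A b c * N a b c)
        - (1 / 2) * (∑ c, ∑ e, (invDiag M x a * invDiag M x c * invDiag M x e : ℂ) * A a c * N c e e)
        - (1 / 2) * (∑ b, ∑ d, (invDiag M x b * invDiag M x a * invDiag M x d : ℂ) * A b b * N d a d)
        + (1 / 2) * (∑ b, ∑ e, (invDiag M x b * invDiag M x a * invDiag M x e : ℂ) * A b b * N a e e) := by
  have hc : ∀ i j, ((Matrix.diagonal (invDiag M x) i j : ℝ) : ℂ)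
      = if i = j then (invDiag M x i : ℂ) else 0 := fun i j => by
    rw [Matrix.diagonal_apply]; split_ifs <;> simp
  simp only [symplP, metricInv_eq hM hx]
  push_cast
  simp only [hc, sub_mul, add_mul, Finset.sum_sub_distrib, Finset.sum_add_distrib, Finset.mul_sum]
  congr 1; congr 1; congr 1; congr 1
  all_goals
    simp [mul_ite, ite_mul, Finset.sum_ite_irrel, mul_assoc]

theorem IsNullPert.symplP_eq_zero (hM : 0 < M) (h : IsNullPert M γ) (h' : IsNullPert M γ')
    (hx : x ∈ exterior M) (a : Fin 4) :
    ∑ b, ∑ c, ∑ d, ∑ e, ∑ f, (symplP M x a b c d e f : ℂ) * (γ' x b c * cov2 M γ x d e f) = 0 := by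
  rw [sum_symplP hM hx]
  obtain ⟨c, hc⟩ := h'.raise hM hx
  -- The term $\gamma'^{bd}\nabla_d\gamma_{ab}$: the raised $\gamma'$ puts the derivative slot and
  -- one tensor slot in the plane.
  have t1 : ∑ b, ∑ k, (invDiag M x a * invDiag M x b * invDiag M x k : ℂ) * γ' x b k
      * cov2 M γ x k a b = 0 := by
    calc _ = ∑ i, ∑ j, invDiag M x a * c i j *
          ∑ k, nullVec M j x k * ∑ b, cov2 M γ x k a b * nullVec M i x b := by
          have : ∀ b k, (invDiag M x a * invDiag M x b * invDiag M x k : ℂ) * γ' x b k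
              * cov2 M γ x k a b = invDiag M x a * cov2 M γ x k a b *
                ∑ i, ∑ j, c i j * nullVec M i x b * nullVec M j x k := fun b k => by
            rw [← hc]; ring
          simp only [this, Fin.sum_univ_two, Fin.sum_univ_four]
          ring
      _ = 0 := by simp only [h.cov2_contract_contract hM hx, mul_zero, Finset.sum_const_zero]
  -- The term $\gamma'^{bc}\nabla_a\gamma_{bc}$: the derivative direction is free, but both tensor
  -- slots are in the plane, and $-\gamma(k_i,\nabla_a k_j)$ vanishes because $\gamma(k_i,\cdot)$
  -- does.
  have t2 : ∑ b, ∑ k, (invDiag M x a * invDiag M x b * invDiag M x k : ℂ) * γ' x b k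
      * cov2 M γ x a b k = 0 := by
    calc _ = ∑ i, ∑ j, invDiag M x a * c i j *
          ∑ b, nullVec M i x b * ∑ k, cov2 M γ x a b k * nullVec M j x k := by
          have : ∀ b k, (invDiag M x a * invDiag M x b * invDiag M x k : ℂ) * γ' x b k
              * cov2 M γ x a b k = invDiag M x a * cov2 M γ x a b k *
                ∑ i, ∑ j, c i j * nullVec M i x b * nullVec M j x k := fun b k => by
            rw [← hc]; ring
          simp only [this, Fin.sum_univ_two, Fin.sum_univ_four]
          ring
      _ = 0 := by
          refine Finset.sum_eq_zero fun i _ => Finset.sum_eq_zero fun j _ => ?_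
          have : ∑ b, nullVec M i x b * ∑ f, γ x b f * covVec M (nullVec M j) x a f
              = ∑ f, (∑ b, γ x f b * nullVec M i x b) * covVec M (nullVec M j) x a f := by
            simp only [Finset.mul_sum, Finset.sum_mul]
            rw [Finset.sum_comm]
            exact Finset.sum_congr rfl fun f _ => Finset.sum_congr rfl fun b _ => by
              rw [h.symm hx b f]; ring
          simp only [h.cov2_contract hM hx, mul_neg, Finset.sum_neg_distrib, this,
            h.contract hM hx, zero_mul, Finset.sum_const_zero, mul_zero, neg_zero]
  have t3 : ∑ k, ∑ e, (invDiag M x a * invDiag M x k * invDiag M x e : ℂ) * γ' x a k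
      * cov2 M γ x k e e = 0 := by
    refine Finset.sum_eq_zero fun k _ => ?_
    calc _ = (invDiag M x a * invDiag M x k * γ' x a k : ℂ)
          * ∑ e, (invDiag M x e : ℂ) * cov2 M γ x k e e := by
          rw [Finset.mul_sum]; exact Finset.sum_congr rfl fun e _ => by ring
      _ = 0 := by rw [h.cov2_trace hM hx, mul_zero]
  -- Both remaining terms contain the trace of $\gamma'$, whatever the other factor `N`.
  have t4 : ∀ N : Fin 4 → ℂ, ∑ b, ∑ d, (invDiag M x b * invDiag M x a * invDiag M x d : ℂ)
      * γ' x b b * N d = 0 := fun N => by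
    calc _ = (∑ b, (invDiag M x b : ℂ) * γ' x b b) * ∑ d, invDiag M x a * invDiag M x d * N d := by
          rw [Finset.sum_mul_sum]
          exact Finset.sum_congr rfl fun b _ => Finset.sum_congr rfl fun d _ => by ring
      _ = 0 := by rw [h'.trace hM hx, zero_mul]
  rw [t1, t2, t3, t4, t4]
  ring

/-- The symplectic current of two perturbations with slots in the same totally null plane. -/
theorem IsNullPert.symplCurrent_eq_zero (hM : 0 < M) (h : IsNullPert M γ) (h' : IsNullPert M γ')
    (hx : x ∈ exterior M) (a : Fin 4) : symplCurrent M γ γ' x a = 0 := by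
  simp only [symplCurrent, mul_sub, Finset.sum_sub_distrib, h.symplP_eq_zero hM h' hx,
    h'.symplP_eq_zero hM h hx, sub_zero]

/-! ### Real and imaginary parts. -/

theorem cov2_rePert (h : ∀ a b, DifferentiableAt ℝ (fun y => γ y a b) x) (d e f : Fin 4) :
    cov2 M (rePert γ) x d e f = ((cov2 M γ x d e f).re : ℂ) := by
  have h1 : pd d (fun y => ((γ y e f).re : ℂ)) x = ((pd d (fun y => γ y e f) x).re : ℂ) :=
    pd_clm (Complex.ofRealCLM.comp Complex.reCLM) (h e f) d
  simp [cov2, h1, rePert, Fin.sum_univ_four]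

theorem cov2_imPert (h : ∀ a b, DifferentiableAt ℝ (fun y => γ y a b) x) (d e f : Fin 4) :
    cov2 M (imPert γ) x d e f = ((cov2 M γ x d e f).im : ℂ) := by
  have h1 : pd d (fun y => ((γ y e f).im : ℂ)) x = ((pd d (fun y => γ y e f) x).im : ℂ) :=
    pd_clm (Complex.ofRealCLM.comp Complex.imCLM) (h e f) d
  simp [cov2, h1, imPert, Fin.sum_univ_four]

theorem lieT_rePert (h : ∀ a b, DifferentiableAt ℝ (fun y => γ y a b) x) (a b : Fin 4) :
    lieT (rePert γ) x a b = rePert (lieT γ) x a b :=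
  pd_clm (Complex.ofRealCLM.comp Complex.reCLM) (h a b) 0

theorem lieT_imPert (h : ∀ a b, DifferentiableAt ℝ (fun y => γ y a b) x) (a b : Fin 4) :
    lieT (imPert γ) x a b = imPert (lieT γ) x a b :=
  pd_clm (Complex.ofRealCLM.comp Complex.imCLM) (h a b) 0

theorem conjPert_rePert (γ : Tensor2) : conjPert (rePert γ) = rePert γ := by
  funext x a b; simp [conjPert, rePert]

theorem conjPert_imPert (γ : Tensor2) : conjPert (imPert γ) = imPert γ := by
  funext x a b; simp [conjPert, imPert]

theorem symplCurrent_congr {γ₁ γ₂ γ₃ γ₄ : Tensor2} (h : γ₁ =ᶠ[nhds x] γ₃) (h' : γ₂ =ᶠ[nhds x] γ₄)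
    (a : Fin 4) : symplCurrent M γ₁ γ₂ x a = symplCurrent M γ₃ γ₄ x a := by
  have hc : ∀ {γ γ' : Tensor2}, γ =ᶠ[nhds x] γ' → ∀ d e f, cov2 M γ x d e f = cov2 M γ' x d e f := by
    intro γ γ' h d e f
    have : (fun y => γ y e f) =ᶠ[nhds x] fun y => γ' y e f := by
      filter_upwards [h] with y hy
      rw [hy]
    simp only [cov2, pd_congr this, h.eq_of_nhds]
  simp only [symplCurrent, hc h, hc h', h.eq_of_nhds, h'.eq_of_nhds]

/-- This is
$\operatorname{Re}(zw)=\operatorname{Re}z\operatorname{Re}w-\operatorname{Im}z\operatorname{Im}w$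
termwise: $P$ and the Christoffel symbols are real, and $w$ is bilinear rather than sesquilinear. -/
theorem symplCurrent_rePert_sub_imPert (h : ∀ a b, DifferentiableAt ℝ (fun y => γ y a b) x)
    (h' : ∀ a b, DifferentiableAt ℝ (fun y => γ' y a b) x) (a : Fin 4) :
    symplCurrent M (rePert γ) (rePert γ') x a - symplCurrent M (imPert γ) (imPert γ') x a
      = ((symplCurrent M γ γ' x a).re : ℂ) := by
  simp only [symplCurrent, cov2_rePert h, cov2_rePert h', cov2_imPert h, cov2_imPert h',
    ← Finset.sum_sub_distrib, Complex.re_sum, Complex.ofReal_sum]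
  refine Finset.sum_congr rfl fun b _ => Finset.sum_congr rfl fun c _ =>
    Finset.sum_congr rfl fun d _ => Finset.sum_congr rfl fun e _ =>
    Finset.sum_congr rfl fun f _ => ?_
  rw [Complex.re_ofReal_mul, Complex.sub_re, Complex.mul_re, Complex.mul_re]
  simp only [rePert, imPert]
  push_cast
  ring

/-- The energy currents of the real and imaginary parts agree. -/
theorem IsNullPert.symplCurrent_rePert_eq_imPert (hM : 0 < M) (h : IsNullPert M γ)
    (hx : x ∈ exterior M) (a : Fin 4) :
    symplCurrent M (conjPert (rePert γ)) (Schwarzschild.lieT (rePert γ)) x a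
      = symplCurrent M (conjPert (imPert γ)) (Schwarzschild.lieT (imPert γ)) x a := by
  have hl := h.lieT hM
  -- Equality near $x$ and not only at $x$ is required, because the current differentiates its
  -- arguments.
  have e1 : Schwarzschild.lieT (rePert γ) =ᶠ[nhds x] rePert (Schwarzschild.lieT γ) := by
    filter_upwards [exterior_mem_nhds hx] with y hy
    funext a b
    exact lieT_rePert (h.differentiableAt hM hy) a b
  have e2 : Schwarzschild.lieT (imPert γ) =ᶠ[nhds x] imPert (Schwarzschild.lieT γ) := by
    filter_upwards [exterior_mem_nhds hx] with y hy
    funext a b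
    exact lieT_imPert (h.differentiableAt hM hy) a b
  rw [conjPert_rePert, conjPert_imPert, symplCurrent_congr .rfl e1, symplCurrent_congr .rfl e2,
    ← sub_eq_zero,
    symplCurrent_rePert_sub_imPert (h.differentiableAt hM hx) (hl.differentiableAt hM hx),
    h.symplCurrent_eq_zero hM hl hx]
  simp

end

/-! ### Linearized connection and curvature on the null plane. -/

section

variable {M : ℝ} {x : Point} {γ γ' : Tensor2}

theorem contDiffOn_christoffel (hM : 0 < M) (a b c : Fin 4) :
    ContDiffOn ℝ ∞ (christoffel M a b c) (exterior M) := by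
  have hg : ∀ i j, ContDiffOn ℝ ∞ (fun y => metric M y i j) (exterior M) := fun i j => by
    by_cases h : i = j
    · subst h; exact contDiffOn_metric M hM i
    · exact (contDiffOn_const (c := (0 : ℝ))).congr fun y _ => Matrix.diagonal_apply_ne _ h
  have hi : ∀ i j, ContDiffOn ℝ ∞ (fun y => metricInv M y i j) (exterior M) := fun i j => by
    by_cases h : i = j
    · subst h
      refine (contDiffOn_invDiag hM i).congr fun y hy => ?_
      rw [metricInv_eq hM hy, Matrix.diagonal_apply_eq]
    · refine (contDiffOn_const (c := (0 : ℝ))).congr fun y hy => ?_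
      rw [metricInv_eq hM hy, Matrix.diagonal_apply_ne _ h]
  exact contDiffOn_const.mul (ContDiffOn.sum fun d _ => (hi a d).mul
    (((contDiffOn_pd (hg d c) b).add (contDiffOn_pd (hg b d) c)).sub (contDiffOn_pd (hg b c) d)))

theorem contDiffOn_cov2 (hM : 0 < M) (h : ∀ a b, ContDiffOn ℝ ∞ (fun y => γ y a b) (exterior M))
    (d e f : Fin 4) : ContDiffOn ℝ ∞ (fun y => cov2 M γ y d e f) (exterior M) := by
  have hc := fun a b c => Complex.ofRealCLM.contDiff.comp_contDiffOn (contDiffOn_christoffel hM a b c)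
  exact ((contDiffOn_pd (h e f) d).sub (ContDiffOn.sum fun k _ => (hc k d e).mul (h k f))).sub
    (ContDiffOn.sum fun k _ => (hc k d f).mul (h e k))

theorem contDiffOn_linConn (hM : 0 < M)
    (h : ∀ a b, ContDiffOn ℝ ∞ (fun y => γ y a b) (exterior M)) (d b c : Fin 4) :
    ContDiffOn ℝ ∞ (fun y => linConn M γ y d b c) (exterior M) := by
  have hc := contDiffOn_cov2 hM h
  exact contDiffOn_const.mul (((hc b d c).add (hc c b d)).sub (hc d b c))

/-- Each of the three terms $\nabla\gamma$ already vanishes once its derivative slot and one tensor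
slot are contracted with the plane. -/
theorem IsNullPert.linConn_contract (hM : 0 < M) (h : IsNullPert M γ) (hx : x ∈ exterior M)
    (i j l : Fin 2) :
    ∑ d, (∑ b, (∑ c, linConn M γ x d b c * nullVec M l x c) * nullVec M j x b) * nullVec M i x d
      = 0 := by
  have h1 := h.cov2_contract_contract hM hx j l
  have h2 := h.cov2_contract_contract hM hx l i
  have h3 := h.cov2_contract_contract hM hx i l
  calc _ = (1 / 2) * (
        ∑ d, nullVec M i x d * (∑ b, nullVec M j x b * ∑ c, cov2 M γ x b d c * nullVec M l x c)
        + ∑ b, nullVec M j x b * (∑ c, nullVec M l x c * ∑ d, cov2 M γ x c b d * nullVec M i x d)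
        - ∑ b, nullVec M j x b * (∑ d, nullVec M i x d * ∑ c, cov2 M γ x d b c * nullVec M l x c))
        := by
        simp only [linConn, Fin.sum_univ_four]
        ring
    _ = 0 := by simp only [h1, h2, h3, mul_zero, Finset.sum_const_zero]; ring

/-- Differentiate $S(k_i,k_j,k_l)=0$ along $k_n$. The three Leibniz corrections have $\nabla_{k_n}k$
in one slot, again a vector of the plane. -/
theorem IsNullPert.cov3_contract (hM : 0 < M) (h : IsNullPert M γ) (hx : x ∈ exterior M)
    (i j l n : Fin 2) :
    ∑ a, nullVec M n x a * ∑ d, (∑ b, (∑ c, cov3 M (linConn M γ) x a d b c * nullVec M l x c)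
      * nullVec M j x b) * nullVec M i x d = 0 := by
  have hS : ∀ d b c, DifferentiableAt ℝ (fun y => linConn M γ y d b c) x := fun d b c =>
    differentiableAt_of_contDiffOn (contDiffOn_linConn hM (h.contDiffOn hM) d b c) hx
  have hk := differentiableAt_nullVec (M := M) hx
  have h0 : (fun y => ∑ d, (∑ b, (∑ c, linConn M γ y d b c * nullVec M l y c) * nullVec M j y b)
      * nullVec M i y d) =ᶠ[nhds x] fun _ => 0 := by
    filter_upwards [exterior_mem_nhds hx] with y hy using h.linConn_contract hM hy i j l
  -- `e2` and `e3` bring the differentiated slot to the outside, so that the rest is a covector to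
  -- which `sum_covVec_eq_zero` applies.
  have e2 : ∀ (w v : Fin 4 → ℂ), ∑ d, (∑ b, (∑ c, linConn M γ x d b c * nullVec M l x c) * v b) * w d
      = ∑ b, (∑ d, (∑ c, linConn M γ x d b c * nullVec M l x c) * w d) * v b := fun w v => by
    simp only [Finset.sum_mul]
    rw [Finset.sum_comm]
    exact Finset.sum_congr rfl fun b _ => Finset.sum_congr rfl fun d _ =>
      Finset.sum_congr rfl fun c _ => by ring
  have e3 : ∀ (u : Fin 4 → ℂ), ∑ d, (∑ b, (∑ c, linConn M γ x d b c * u c) * nullVec M j x b)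
      * nullVec M i x d
      = ∑ c, (∑ d, (∑ b, linConn M γ x d b c * nullVec M j x b) * nullVec M i x d) * u c :=
      fun u => by
    simp only [Fin.sum_univ_four]
    ring
  simp only [cov3_contract_all hS (hk i) (hk j) (hk l), pd_congr h0, pd_const, mul_sub,
    Finset.sum_sub_distrib, mul_zero, Finset.sum_const_zero]
  rw [sum_covVec_eq_zero hM hx (fun i => h.linConn_contract hM hx i j l)]
  have f2 : ∑ a, nullVec M n x a * ∑ d, (∑ b, (∑ c, linConn M γ x d b c * nullVec M l x c)
      * covVec M (nullVec M j) x a b) * nullVec M i x d = 0 := by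
    simp only [e2]
    refine sum_covVec_eq_zero hM hx (fun j => ?_) n j
    rw [← e2]
    exact h.linConn_contract hM hx i j l
  have f3 : ∑ a, nullVec M n x a * ∑ d, (∑ b, (∑ c, linConn M γ x d b c
      * covVec M (nullVec M l) x a c) * nullVec M j x b) * nullVec M i x d = 0 := by
    simp only [e3]
    refine sum_covVec_eq_zero hM hx (fun l => ?_) n l
    rw [← e3]
    exact h.linConn_contract hM hx i j l
  rw [f2, f3]
  ring

/-- Isolates the factor $g(k,k')$ in the Ricci and scalar corrections of the Weyl tensor. -/
theorem sum_mul_sum_pairs (G R : Fin 4 → Fin 4 → ℂ) (u v w z : Fin 4 → ℂ) :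
    ∑ a, ∑ b, ∑ c, ∑ d, G a c * R d b * u a * v b * w c * z d
      = (∑ a, ∑ c, G a c * u a * w c) * ∑ d, ∑ b, R d b * z d * v b := by
  calc _ = ∑ a, ∑ c, ∑ d, ∑ b, (G a c * u a * w c) * (R d b * z d * v b) := by
        refine Finset.sum_congr rfl fun a _ => ?_
        rw [Finset.sum_comm]
        refine Finset.sum_congr rfl fun c _ => ?_
        rw [Finset.sum_comm]
        exact Finset.sum_congr rfl fun d _ => Finset.sum_congr rfl fun b _ => by ring
    _ = _ := by simp only [← Finset.mul_sum, ← Finset.sum_mul]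

theorem metric_contract (hM : 0 < M) (hx : x ∈ exterior M) (i j : Fin 2) :
    ∑ a, ∑ c, (metric M x a c : ℂ) * nullVec M i x a * nullVec M j x c = 0 := by
  rw [← metric_nullVec hM hx i j]
  refine Finset.sum_congr rfl fun a _ => Finset.sum_eq_single a (fun c _ hc => ?_) (by simp)
  have : metric M x a c = 0 := Matrix.diagonal_apply_ne _ hc.symm
  simp [this]

/-- The linearized Riemann tensor of a null perturbation vanishes on its null plane. -/
theorem IsNullPert.linRiemann_contract (hM : 0 < M) (h : IsNullPert M γ) (hx : x ∈ exterior M)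
    (i j l n : Fin 2) :
    ∑ a, ∑ b, ∑ c, ∑ d, linRiemann M γ x a b c d * nullVec M i x a * nullVec M j x b
      * nullVec M l x c * nullVec M n x d = 0 := by
  have r1 : ∑ a, ∑ b, ∑ c, ∑ d, cov3 M (linConn M γ) x b d a c * nullVec M i x a * nullVec M j x b
      * nullVec M l x c * nullVec M n x d = 0 := by
    rw [← h.cov3_contract hM hx n i l j, Finset.sum_comm]
    refine Finset.sum_congr rfl fun b _ => ?_
    simp only [Finset.mul_sum, Finset.sum_mul]
    conv_rhs => rw [Finset.sum_comm]
    refine Finset.sum_congr rfl fun a _ => ?_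
    rw [Finset.sum_comm]
    exact Finset.sum_congr rfl fun d _ => Finset.sum_congr rfl fun c _ => by ring
  have r2 : ∑ a, ∑ b, ∑ c, ∑ d, cov3 M (linConn M γ) x a d b c * nullVec M i x a * nullVec M j x b
      * nullVec M l x c * nullVec M n x d = 0 := by
    rw [← h.cov3_contract hM hx n j l i]
    refine Finset.sum_congr rfl fun a _ => ?_
    simp only [Finset.mul_sum, Finset.sum_mul]
    conv_rhs => rw [Finset.sum_comm]
    refine Finset.sum_congr rfl fun b _ => ?_
    rw [Finset.sum_comm]
    exact Finset.sum_congr rfl fun d _ => Finset.sum_congr rfl fun c _ => by ring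
  -- The term from lowering the index with the perturbed metric has $\gamma(k_n,\cdot)=0$ as a
  -- factor; the background curvature plays no role.
  have r3 : ∀ a b c, ∑ d, (∑ e, γ x d e * (riemann M x a b c e : ℂ)) * nullVec M i x a
      * nullVec M j x b * nullVec M l x c * nullVec M n x d = 0 := fun a b c => by
    calc _ = ∑ e, (∑ d, γ x e d * nullVec M n x d) * ((riemann M x a b c e : ℂ) * nullVec M i x a
          * nullVec M j x b * nullVec M l x c) := by
          simp only [Finset.sum_mul]
          rw [Finset.sum_comm]
          exact Finset.sum_congr rfl fun e _ => Finset.sum_congr rfl fun d _ => by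
            rw [h.symm hx d e]; ring
      _ = 0 := by simp only [h.contract hM hx, zero_mul, Finset.sum_const_zero]
  simp only [linRiemann, linRiemannMixed, add_mul, sub_mul, Finset.sum_add_distrib,
    Finset.sum_sub_distrib, r1, r2, r3, Finset.sum_const_zero]
  ring

theorem IsNullPert.linWeyl_contract (hM : 0 < M) (h : IsNullPert M γ) (hx : x ∈ exterior M)
    (i j l n : Fin 2) :
    ∑ a, ∑ b, ∑ c, ∑ d, linWeyl M γ x a b c d * nullVec M i x a * nullVec M j x b
      * nullVec M l x c * nullVec M n x d = 0 := by
  have hg := metric_contract hM hx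
  set g : Fin 4 → Fin 4 → ℂ := fun i j => (metric M x i j : ℂ) with hgdef
  -- One identity for each index pair on $g$. `R` is arbitrary so as to cover both the linearized
  -- Ricci tensor and a second factor $g$.
  have q1 : ∀ (R : Fin 4 → Fin 4 → ℂ), ∑ a, ∑ b, ∑ c, ∑ d, g a c * R d b * nullVec M i x a
      * nullVec M j x b * nullVec M l x c * nullVec M n x d = 0 := fun R => by
    rw [sum_mul_sum_pairs, hg, zero_mul]
  have q2 : ∀ (R : Fin 4 → Fin 4 → ℂ), ∑ a, ∑ b, ∑ c, ∑ d, g a d * R c b * nullVec M i x a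
      * nullVec M j x b * nullVec M l x c * nullVec M n x d = 0 := fun R => by
    have := sum_mul_sum_pairs g R (nullVec M i x) (nullVec M j x) (nullVec M n x) (nullVec M l x)
    rw [hg, zero_mul] at this
    rw [← this]
    refine Finset.sum_congr rfl fun a _ => Finset.sum_congr rfl fun b _ => ?_
    rw [Finset.sum_comm]
    exact Finset.sum_congr rfl fun d _ => Finset.sum_congr rfl fun c _ => by ring
  have q3 : ∀ (R : Fin 4 → Fin 4 → ℂ), ∑ a, ∑ b, ∑ c, ∑ d, g b c * R d a * nullVec M i x a
      * nullVec M j x b * nullVec M l x c * nullVec M n x d = 0 := fun R => by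
    have := sum_mul_sum_pairs g R (nullVec M j x) (nullVec M i x) (nullVec M l x) (nullVec M n x)
    rw [hg, zero_mul] at this
    rw [← this, Finset.sum_comm]
    exact Finset.sum_congr rfl fun a _ => Finset.sum_congr rfl fun b _ =>
      Finset.sum_congr rfl fun d _ => Finset.sum_congr rfl fun c _ => by ring
  have q4 : ∀ (R : Fin 4 → Fin 4 → ℂ), ∑ a, ∑ b, ∑ c, ∑ d, g b d * R c a * nullVec M i x a
      * nullVec M j x b * nullVec M l x c * nullVec M n x d = 0 := fun R => by
    have := sum_mul_sum_pairs g R (nullVec M j x) (nullVec M i x) (nullVec M n x) (nullVec M l x)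
    rw [hg, zero_mul] at this
    rw [← this, Finset.sum_comm]
    refine Finset.sum_congr rfl fun a _ => Finset.sum_congr rfl fun b _ => ?_
    rw [Finset.sum_comm]
    exact Finset.sum_congr rfl fun d _ => Finset.sum_congr rfl fun c _ => by ring
  have split : ∀ a b c d, linWeyl M γ x a b c d * nullVec M i x a * nullVec M j x b
      * nullVec M l x c * nullVec M n x d
      = linRiemann M γ x a b c d * nullVec M i x a * nullVec M j x b * nullVec M l x c
          * nullVec M n x d
        - (1 / 2) * (g a c * linRicci M γ x d b * nullVec M i x a * nullVec M j x b
          * nullVec M l x c * nullVec M n x d)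
        + (1 / 2) * (g a d * linRicci M γ x c b * nullVec M i x a * nullVec M j x b
          * nullVec M l x c * nullVec M n x d)
        + (1 / 2) * (g b c * linRicci M γ x d a * nullVec M i x a * nullVec M j x b
          * nullVec M l x c * nullVec M n x d)
        - (1 / 2) * (g b d * linRicci M γ x c a * nullVec M i x a * nullVec M j x b
          * nullVec M l x c * nullVec M n x d)
        + (1 / 6) * linScalar M γ x * (g a c * g d b * nullVec M i x a * nullVec M j x b
          * nullVec M l x c * nullVec M n x d)
        - (1 / 6) * linScalar M γ x * (g a d * g c b * nullVec M i x a * nullVec M j x b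
          * nullVec M l x c * nullVec M n x d) := fun a b c d => by
    simp only [linWeyl, hgdef]
    ring
  simp only [split, Finset.sum_add_distrib, Finset.sum_sub_distrib, ← Finset.mul_sum,
    h.linRiemann_contract hM hx, q1, q2, q3, q4]
  ring

end

/-! ### Smoothness of the Carter frame; Hertz perturbations lie in the null plane. -/

section

variable {M : ℝ} {x : Point} {ψ ξ : Point → ℂ}

/-- The factor between `l` and the vector field `nullVec M 0`. -/
def lScale (M : ℝ) (x : Point) : ℝ := √(Delta M x) / (√2 * x 1)

/-- The factor between `m` and the vector field `nullVec M 1`. -/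
def mScale (x : Point) : ℝ := 1 / (√2 * x 1)

theorem lVec_eq (hM : 0 < M) (hx : x ∈ exterior M) (a : Fin 4) :
    lVec M x a = (lScale M x : ℂ) * nullVec M 0 x a := by
  have hr := (radius_pos hM hx).ne'
  have hf := (radius_sub_pos hx).ne'
  have hD := Delta_pos hM hx
  have h2 : √(2 : ℝ) ≠ 0 := by positivity
  have hq : √(Delta M x) ≠ 0 := (Real.sqrt_pos.2 hD).ne'
  have hs : √(Delta M x) ^ 2 = x 1 * (x 1 - 2 * M) := Real.sq_sqrt hD.le
  -- Because $\Delta=r(r-2M)$, one has $r^2/\sqrt\Delta=\sqrt\Delta\cdot r/(r-2M)$: the square root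
  -- moves entirely into the scale factor.
  have key : 1 / (√2 * x 1) * (x 1 ^ 2 / √(Delta M x)) = lScale M x * (x 1 / (x 1 - 2 * M)) := by
    unfold lScale
    field_simp
    rw [hs]
  fin_cases a
  · simpa [lVec, nullVec] using congrArg (fun t : ℝ => (t : ℂ)) key
  · have : 1 / (√2 * x 1) * √(Delta M x) = lScale M x := by unfold lScale; ring
    simpa [lVec, nullVec] using congrArg (fun t : ℝ => (t : ℂ)) this
  · simp [lVec, nullVec]
  · simp [lVec, nullVec]

theorem mVec_eq (a : Fin 4) : mVec x a = (mScale x : ℂ) * nullVec M 1 x a := by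
  fin_cases a <;> simp [mVec, nullVec, mScale]
  left; ring

theorem contDiffOn_lScale (hM : 0 < M) : ContDiffOn ℝ ∞ (lScale M) (exterior M) := by
  have hD : ContDiffOn ℝ ∞ (Delta M) (exterior M) := by unfold Delta; fun_prop
  exact (hD.sqrt fun y hy => (Delta_pos hM hy).ne').div (by fun_prop) fun y hy =>
    mul_ne_zero (by positivity) (radius_pos hM hy).ne'

theorem contDiffOn_mScale (hM : 0 < M) : ContDiffOn ℝ ∞ mScale (exterior M) :=
  contDiffOn_const.div (by fun_prop) fun y hy =>
    mul_ne_zero (by positivity) (radius_pos hM hy).ne'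

theorem contDiffOn_ofReal {f : Point → ℝ} (hf : ContDiffOn ℝ ∞ f (exterior M)) :
    ContDiffOn ℝ ∞ (fun y => (f y : ℂ)) (exterior M) :=
  Complex.ofRealCLM.contDiff.comp_contDiffOn hf

theorem contDiffOn_lVec (hM : 0 < M) (a : Fin 4) :
    ContDiffOn ℝ ∞ (fun y => lVec M y a) (exterior M) :=
  ((contDiffOn_ofReal (contDiffOn_lScale hM)).mul (contDiffOn_nullVec M 0 a)).congr
    fun _ hy => lVec_eq hM hy a

theorem contDiffOn_mVec (hM : 0 < M) (a : Fin 4) :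
    ContDiffOn ℝ ∞ (fun y => mVec y a) (exterior M) :=
  ((contDiffOn_ofReal (contDiffOn_mScale hM)).mul (contDiffOn_nullVec M 1 a)).congr
    fun _ _ => mVec_eq a

theorem contDiffOn_rho (hM : 0 < M) : ContDiffOn ℝ ∞ (rho M) (exterior M) := by
  have hD : ContDiffOn ℝ ∞ (Delta M) (exterior M) := by unfold Delta; fun_prop
  exact contDiffOn_ofReal (((hD.sqrt fun y hy => (Delta_pos hM hy).ne').div
    (g := fun y : Point => √2 * y 1 ^ 2) (by fun_prop) fun y hy =>
    mul_ne_zero (by positivity) (pow_ne_zero 2 (radius_pos hM hy).ne')).neg)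

theorem contDiffOn_eps (hM : 0 < M) : ContDiffOn ℝ ∞ (eps M) (exterior M) := by
  have hD : ContDiffOn ℝ ∞ (fun y => 2 * Delta M y) (exterior M) := by unfold Delta; fun_prop
  have hpos : ∀ y ∈ exterior M, 0 < 2 * Delta M y := fun y hy =>
    mul_pos two_pos (Delta_pos hM hy)
  exact contDiffOn_ofReal (contDiffOn_const.div
    ((contDiffOn_const.mul (hD.sqrt fun y hy => (hpos y hy).ne')).mul (by fun_prop)) fun y hy =>
    mul_ne_zero (mul_ne_zero two_ne_zero (Real.sqrt_pos.2 (hpos y hy)).ne') (radius_pos hM hy).ne')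

theorem contDiffOn_beta (hM : 0 < M) : ContDiffOn ℝ ∞ beta (exterior M) := by
  have hcot : ContDiffOn ℝ ∞ (fun y : Point => Real.cot (y 2)) (exterior M) := by
    simp only [Real.cot_eq_cos_div_sin]
    exact ContDiffOn.div (by fun_prop) (by fun_prop) fun y hy => (sin_pos hy).ne'
  exact contDiffOn_ofReal (hcot.div (g := fun y : Point => 2 * √2 * y 1) (by fun_prop) fun y hy =>
    mul_ne_zero (by positivity) (radius_pos hM hy).ne')

theorem contDiffOn_along {v : Point → Fin 4 → ℂ}
    (hv : ∀ a, ContDiffOn ℝ ∞ (fun y => v y a) (exterior M)) (hξ : ContDiffOn ℝ ∞ ξ (exterior M)) :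
    ContDiffOn ℝ ∞ (along v ξ) (exterior M) :=
  ContDiffOn.sum fun a _ => (hv a).mul (contDiffOn_pd hξ a)

theorem contDiffOn_conj {f : Point → ℂ} (hf : ContDiffOn ℝ ∞ f (exterior M)) :
    ContDiffOn ℝ ∞ (fun y => starRingEnd ℂ (f y)) (exterior M) :=
  Complex.conjCLE.contDiff.comp_contDiffOn hf

theorem contDiffOn_thorn (hM : 0 < M) (p q : ℤ) (hξ : ContDiffOn ℝ ∞ ξ (exterior M)) :
    ContDiffOn ℝ ∞ (thorn M p q ξ) (exterior M) :=
  ((contDiffOn_along (contDiffOn_lVec hM) hξ).sub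
    ((contDiffOn_const.mul (contDiffOn_eps hM)).mul hξ)).sub
    ((contDiffOn_const.mul (contDiffOn_conj (contDiffOn_eps hM))).mul hξ)

theorem contDiffOn_eth (hM : 0 < M) (p q : ℤ) (hξ : ContDiffOn ℝ ∞ ξ (exterior M)) :
    ContDiffOn ℝ ∞ (eth p q ξ) (exterior M) :=
  ((contDiffOn_along (contDiffOn_mVec hM) hξ).sub
    ((contDiffOn_const.mul (contDiffOn_beta hM)).mul hξ)).add
    ((contDiffOn_const.mul (contDiffOn_conj (contDiffOn_beta hM))).mul hξ)

theorem contDiffOn_etaOf (hM : 0 < M) (hψ : ContDiffOn ℝ ∞ ψ (exterior M)) :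
    ContDiffOn ℝ ∞ (etaOf M ψ) (exterior M) :=
  (contDiffOn_thorn hM _ _ hψ).add ((contDiffOn_const.mul (contDiffOn_rho hM)).mul hψ)

theorem contDiffOn_hertzU (hM : 0 < M) (hψ : ContDiffOn ℝ ∞ ψ (exterior M)) :
    ContDiffOn ℝ ∞ (hertzU ψ) (exterior M) :=
  contDiffOn_eth hM _ _ (contDiffOn_eth hM _ _ hψ)

theorem contDiffOn_hertzV (hM : 0 < M) (hψ : ContDiffOn ℝ ∞ ψ (exterior M)) :
    ContDiffOn ℝ ∞ (hertzV M ψ) (exterior M) :=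
  (contDiffOn_thorn hM _ _ (contDiffOn_eth hM _ _ hψ)).add
    (contDiffOn_eth hM _ _ (contDiffOn_etaOf hM hψ))

theorem contDiffOn_hertzW (hM : 0 < M) (hψ : ContDiffOn ℝ ∞ ψ (exterior M)) :
    ContDiffOn ℝ ∞ (hertzW M ψ) (exterior M) :=
  (contDiffOn_thorn hM _ _ (contDiffOn_etaOf hM hψ)).sub
    ((contDiffOn_rho hM).mul (contDiffOn_etaOf hM hψ))

theorem lower_eq (v : Fin 4 → ℂ) (a : Fin 4) : lower M x v a = (metric M x a a : ℂ) * v a :=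
  Finset.sum_eq_single a (fun b _ hb => by
    have : metric M x a b = 0 := Matrix.diagonal_apply_ne _ hb.symm
    simp [this]) (by simp)

/-- The coefficients are $-U$, $\frac12V$, $-W$ times the scale factors of $l$ and $m$; the
$\frac12$ comes from the symmetrization $l_{(a}m_{b)}$. -/
theorem isNullPert_hertzPert (hM : 0 < M) (hψ : ContDiffOn ℝ ∞ ψ (exterior M)) :
    IsNullPert M (hertzPert M ψ) := by
  have hl := contDiffOn_ofReal (contDiffOn_lScale hM)
  have hm := contDiffOn_ofReal (contDiffOn_mScale hM)
  have hU := contDiffOn_hertzU hM hψ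
  have hV := contDiffOn_hertzV hM hψ
  have hW := contDiffOn_hertzW hM hψ
  let U : Point → ℂ := fun y => -(lScale M y * lScale M y * hertzU ψ y)
  let V : Point → ℂ := fun y => 1 / 2 * (lScale M y * mScale y * hertzV M ψ y)
  let W : Point → ℂ := fun y => -(mScale y * mScale y * hertzW M ψ y)
  have hU' : ContDiffOn ℝ ∞ U (exterior M) := ((hl.mul hl).mul hU).neg
  have hV' : ContDiffOn ℝ ∞ V (exterior M) := contDiffOn_const.mul ((hl.mul hm).mul hV)
  have hW' : ContDiffOn ℝ ∞ W (exterior M) := ((hm.mul hm).mul hW).neg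
  refine ⟨![![U, V], ![V, W]], fun i j => ?_, rfl, fun x hx a b => ?_⟩
  · fin_cases i <;> fin_cases j
    exacts [hU', hV', hV', hW']
  · simp only [hertzPert, lower_eq, lVec_eq hM hx, mVec_eq (M := M), Fin.sum_univ_two]
    simp only [Matrix.cons_val_zero, Matrix.cons_val_one, U, V, W]
    ring

theorem weylT_hertzPert (hM : 0 < M) (hψ : ContDiffOn ℝ ∞ ψ (exterior M)) (hx : x ∈ exterior M) :
    weylT M (hertzPert M ψ) x = 0 := by
  have h := (isNullPert_hertzPert hM hψ).linWeyl_contract hM hx 0 1 0 1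
  have e : ∀ a b c d, linWeyl M (hertzPert M ψ) x a b c d * lVec M x a * mVec x b * lVec M x c
      * mVec x d = (lScale M x ^ 2 * mScale x ^ 2) * (linWeyl M (hertzPert M ψ) x a b c d
        * nullVec M 0 x a * nullVec M 1 x b * nullVec M 0 x c * nullVec M 1 x d) := fun a b c d => by
    rw [lVec_eq hM hx, lVec_eq hM hx, mVec_eq (M := M), mVec_eq (M := M)]
    ring
  simp only [weylT, e, ← Finset.mul_sum, h, mul_zero, neg_zero]

/-! ### From pointwise currents to integrals over a slice. -/

theorem slice_mem_exterior {τ : ℝ} {y : Fin 3 → ℝ} (hy : y ∈ sliceDomain M) :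
    (Fin.cons τ y : Point) ∈ exterior M :=
  ⟨hy.1, hy.2.1.1, hy.2.1.2⟩

theorem measurableSet_sliceDomain (M : ℝ) : MeasurableSet (sliceDomain M) := by
  have h0 : Measurable fun y : Fin 3 → ℝ => y 0 := measurable_pi_apply 0
  have h1 : Measurable fun y : Fin 3 → ℝ => y 1 := measurable_pi_apply 1
  have h2 : Measurable fun y : Fin 3 → ℝ => y 2 := measurable_pi_apply 2
  exact (measurableSet_lt measurable_const h0).inter
    (((measurableSet_lt measurable_const h1).inter (measurableSet_lt h1 measurable_const)).inter
      ((measurableSet_lt measurable_const h2).inter (measurableSet_lt h2 measurable_const)))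

theorem symplDensity_congr {γ₁ γ₂ γ₃ γ₄ : Tensor2}
    (h : ∀ x ∈ exterior M, ∀ a, symplCurrent M γ₁ γ₂ x a = symplCurrent M γ₃ γ₄ x a) (τ : ℝ) :
    Set.EqOn (symplDensity M τ γ₁ γ₂) (symplDensity M τ γ₃ γ₄) (sliceDomain M) := fun y hy => by
  simp only [symplDensity, h _ (slice_mem_exterior hy)]

theorem IsNullPert.symplDensity_eqOn_zero {γ γ' : Tensor2} (hM : 0 < M) (h : IsNullPert M γ)
    (h' : IsNullPert M γ') (τ : ℝ) :
    Set.EqOn (symplDensity M τ γ γ') (fun _ => 0) (sliceDomain M) := fun y hy => by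
  simp [symplDensity, h.symplCurrent_eq_zero hM h' (slice_mem_exterior hy)]

end

end Schwarzschild

end

theorem mainTheorem3 (M : ℝ) (hM : 0 < M) :
    (∀ ψ ψ' : Schwarzschild.Point → ℂ,
      Schwarzschild.IsHertzPotential M ψ → Schwarzschild.IsHertzPotential M ψ' → ∀ τ : ℝ,
        Schwarzschild.OmegaConverges M τ
          (Schwarzschild.hertzPert M ψ) (Schwarzschild.hertzPert M ψ') ∧
        Schwarzschild.Omega M τ
          (Schwarzschild.hertzPert M ψ) (Schwarzschild.hertzPert M ψ') = 0) ∧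
    (∀ ψ : Schwarzschild.Point → ℂ, Schwarzschild.IsHertzPotential M ψ → ∀ τ : ℝ,
        (Schwarzschild.EnergyConverges M τ
            (Schwarzschild.rePert (Schwarzschild.hertzPert M ψ)) ↔
          Schwarzschild.EnergyConverges M τ
            (Schwarzschild.imPert (Schwarzschild.hertzPert M ψ))) ∧
        Schwarzschild.energy M τ (Schwarzschild.rePert (Schwarzschild.hertzPert M ψ)) =
          Schwarzschild.energy M τ (Schwarzschild.imPert (Schwarzschild.hertzPert M ψ))) ∧
    (∀ ψ : Schwarzschild.Point → ℂ, Schwarzschild.IsHertzPotential M ψ →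
      ∀ x ∈ Schwarzschild.exterior M,
        Schwarzschild.weylT M (Schwarzschild.hertzPert M ψ) x = 0) := by
  open Schwarzschild in
  refine ⟨fun ψ ψ' hψ hψ' τ => ?_, fun ψ hψ τ => ?_,
    fun ψ hψ x hx => weylT_hertzPert hM hψ.smooth hx⟩
  · have h := (isNullPert_hertzPert hM hψ.smooth).symplDensity_eqOn_zero hM
      (isNullPert_hertzPert hM hψ'.smooth) τ
    refine ⟨MeasureTheory.integrableOn_zero.congr_fun h.symm (measurableSet_sliceDomain M), ?_⟩
    rw [Omega, MeasureTheory.setIntegral_congr_fun (measurableSet_sliceDomain M) h]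
    simp
  · have h := symplDensity_congr (fun x hx =>
      (isNullPert_hertzPert hM hψ.smooth).symplCurrent_rePert_eq_imPert hM hx) τ
    -- The two energy densities agree on the slice, so the integrals agree whether or not they
    -- converge.
    exact ⟨MeasureTheory.integrableOn_congr_fun h (measurableSet_sliceDomain M),
      MeasureTheory.setIntegral_congr_fun (measurableSet_sliceDomain M) h⟩
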